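/- Let $[u]$ be a non-zero entire odd function on $\mathbb{C}$ satisfying, for all $x,y,u,v\in\mathbb{C}$, $$[x\pm u][y\pm v]-[x\pm v][y\pm u]=[x\pm y][u\pm v],\qquad [a\pm b]:=[a+b][a-b]$$ (for example $[u]=e^{2\pi i a u^2}\sigma(u;\Omega)$ with $\sigma$ the Weierstrass sigma function of a lattice $\Omega\subset\mathbb{C}$ and $a\in\mathbb{C}$). Let $\Omega$ be its set of zeros and fix $\delta\in\mathbb{C}^*$ with $\mathbb{Z}\delta\cap\Omega=\{0\}$. For $k\in\mathbb{N}=\{0,1,2,\dots\}$ put $[u]_k=[u][u+\delta]\cdots[u+(k-1)\delta]$ and $[u\pm v]_k=[u+v]_k[u-v]_k$. For $\gamma\in\mathbb{N}^n$, $z=(z_1,\dots,z_n)$ and $w=(w_1,\dots,w_l)$ define $$\Phi_\gamma(z|w)=\sum_{0\le\mu\le\gamma}\ \prod_{i=1}^n\frac{[2z_i+2\mu_i\delta]}{[2z_i]}\prod_{1\le i<j\le n}\frac{[(z_i+\mu_i\delta)\pm(z_j+\mu_j\delta)]}{[z_i\pm z_j]}\prod_{1\le i,j\le n}\frac{[z_i+z_j]_{\mu_i}[z_i-z_j-\gamma_j\delta]_{\mu_i}}{[z_i+z_j+(\gamma_j+1)\delta]_{\mu_i}[z_i-z_j+\delta]_{\mu_i}}\prod_{\substack{1\le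 i\le n\\1\le k\le l}}\frac{[z_i+w_k]_{\mu_i}}{[z_i-w_k+\delta]_{\mu_i}},$$ where the sum is over $\mu\in\mathbb{N}^n$ with $0\le\mu_i\le\gamma_i$ for all $i$. Theorem (multiple Karlsson–Minton type transformation). Let $N,r,s\ge 0$ be integers and let $\alpha\in\mathbb{N}^m$, $\beta\in\mathbb{N}^n$ be multi-indices with $|\alpha|=N+r+s$ and $|\beta|=N$. For variables $x=(x_1,\dots,x_m)$, $y=(y_1,\dots,y_n)$ and parameters $u,v$ in $\mathbb{C}$ at which none of the denominators below (including those in the summands of the two functions $\Phi$) vanishes, $$\frac{[v+\delta\pm v]_s\,[u+\delta\pm v]_r\prod_{k=1}^n[y_k+\delta\pm v]_{\beta_k}}{\prod_{i=1}^m[x_i+\tfrac{\delta}{2}\pm v]_{\alpha_i}}\ \Phi_{(\beta,r)}\!\left(y,u\,\middle|\,v,\,-v-s\delta,\,(\tfrac{\delta}{2}+x_i+\alpha_i\delta,\ \tfrac{\delta}{2}-x_i)_{1\le i\le m}\right)$$ $$=\frac{[u+\delta\pm u]_r\,[v+\delta\pm u]_s\prod_{k=1}^n[y_k+\delta\pm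 u]_{\beta_k}}{\prod_{i=1}^m[x_i+\tfrac{\delta}{2}\pm u]_{\alpha_i}}\ \Phi_{(\beta,s)}\!\left(y,v\,\middle|\,u,\,-u-r\delta,\,(\tfrac{\delta}{2}+x_i+\alpha_i\delta,\ \tfrac{\delta}{2}-x_i)_{1\le i\le m}\right).$$ -/

import Mathlib

open Finset

/-- The functions `[u]`: non-zero entire odd functions satisfying
`[x ± u][y ± v] - [x ± v][y ± u] = [x ± y][u ± v]`, where `[a ± b] = [a + b][a - b]`. -/
structure IsBracket (br : ℂ → ℂ) : Prop where
  entire : Differentiable ℂ br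
  odd : ∀ u, br (-u) = -br u
  ne_zero : ∃ u, br u ≠ 0
  riemann : ∀ x y u v,
    (br (x + u) * br (x - u)) * (br (y + v) * br (y - v))
      - (br (x + v) * br (x - v)) * (br (y + u) * br (y - u))
      = (br (x + y) * br (x - y)) * (br (u + v) * br (u - v))

/-- `[u]_k = [u][u + δ] ⋯ [u + (k - 1)δ]`. -/
def shiftedBracket (br : ℂ → ℂ) (δ u : ℂ) (k : ℕ) : ℂ :=
  ∏ j ∈ range k, br (u + j * δ)

/-- `[a ± b]_k = [a + b]_k [a - b]_k`. -/
def shiftedBracketPM (br : ℂ → ℂ) (δ a b : ℂ) (k : ℕ) : ℂ :=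
  shiftedBracket br δ (a + b) k * shiftedBracket br δ (a - b) k

/-- The summand of `Φ_γ(z | w)` at the multi-index `μ`. The parameters `w` are indexed by an
arbitrary finite type; the summand does not depend on their order. -/
noncomputable def phiTerm (br : ℂ → ℂ) (δ : ℂ) {n : ℕ} {ι : Type} [Fintype ι]
    (γ : Fin n → ℕ) (z : Fin n → ℂ) (w : ι → ℂ) (μ : Fin n → ℕ) : ℂ :=
  (∏ i, br (2 * z i + 2 * μ i * δ) / br (2 * z i))
  * (∏ i, ∏ j ∈ Ioi i,
      (br ((z i + μ i * δ) + (z j + μ j * δ)) * br ((z i + μ i * δ) - (z j + μ j * δ)))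
        / (br (z i + z j) * br (z i - z j)))
  * (∏ i, ∏ j,
      (shiftedBracket br δ (z i + z j) (μ i) * shiftedBracket br δ (z i - z j - γ j * δ) (μ i))
        / (shiftedBracket br δ (z i + z j + (γ j + 1) * δ) (μ i)
            * shiftedBracket br δ (z i - z j + δ) (μ i)))
  * (∏ i, ∏ k,
      shiftedBracket br δ (z i + w k) (μ i) / shiftedBracket br δ (z i - w k + δ) (μ i))

/-- `Φ_γ(z | w)`, the sum of the terms over all multi-indices `0 ≤ μ ≤ γ`. -/
noncomputable def Phi (br : ℂ → ℂ) (δ : ℂ) {n : ℕ} {ι : Type} [Fintype ι]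
    (γ : Fin n → ℕ) (z : Fin n → ℂ) (w : ι → ℂ) : ℂ :=
  ∑ μ ∈ Iic γ, phiTerm br δ γ z w μ

/-- No denominator occurring in a summand of `Φ_γ(z | w)` vanishes. Since `[a]_k` divides
`[a]_l` for `k ≤ l`, the denominators with `μ = γ` suffice. -/
structure PhiDefined (br : ℂ → ℂ) (δ : ℂ) {n : ℕ} {ι : Type}
    (γ : Fin n → ℕ) (z : Fin n → ℂ) (w : ι → ℂ) : Prop where
  two_mul : ∀ i, br (2 * z i) ≠ 0
  add_sub : ∀ i j, i < j → br (z i + z j) ≠ 0 ∧ br (z i - z j) ≠ 0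
  shift_add : ∀ i j, shiftedBracket br δ (z i + z j + (γ j + 1) * δ) (γ i) ≠ 0
  shift_sub : ∀ i j, shiftedBracket br δ (z i - z j + δ) (γ i) ≠ 0
  param : ∀ i k, shiftedBracket br δ (z i - w k + δ) (γ i) ≠ 0

/-- The parameter list `v, -v - sδ, (δ/2 + x_i + α_i δ, δ/2 - x_i)_{1 ≤ i ≤ m}`. -/
noncomputable def kmParams (δ : ℂ) {m : ℕ} (α : Fin m → ℕ) (x : Fin m → ℂ) (v : ℂ) (s : ℕ) :
    Fin 2 ⊕ (Fin m ⊕ Fin m) → ℂ :=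
  Sum.elim ![v, -v - s * δ]
    (Sum.elim (fun i => δ / 2 + x i + α i * δ) (fun i => δ / 2 - x i))

/-- The multi-index `(β, r)`. -/
def appendIndex {n : ℕ} (β : Fin n → ℕ) (r : ℕ) : Fin (n + 1) → ℕ :=
  Fin.snoc (α := fun _ => ℕ) β r

/-- The variables `(y, u)`. -/
def appendVar {n : ℕ} (y : Fin n → ℂ) (u : ℂ) : Fin (n + 1) → ℂ :=
  Fin.snoc (α := fun _ => ℂ) y u

/-! Both sides are specializations of one expression that does not depend on an auxiliary point c.

Put z = (y,u,v) and γ = (β,r,s), so that |γ| = |α|, and let X run over the |α| points x_i + δ/2 + jδ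
with 0 ≤ j < α_i. Consider the square matrix whose rows, grouped in blocks k, are the consecutive
differences in j of the vectors H_{k,j} = ([z_k + jδ ± c] / [z_k + jδ ± X])_X, 0 ≤ j ≤ γ_k. By the
three-term relation each entry is [c ± X] times a quantity free of c
(`IsBracket.sub_bracketPM_div`), so the determinant is ∏_X [c ± X] times a constant.

Expanding by multilinearity instead, a term survives only if each block omits exactly one vector,
H_{k,μ_k}, and it carries the sign (-1)^|μ| (`alternatingMap_consecutive_differences`). Since [p ±
q] is a 2 × 2 determinant in suitable coordinates (`IsBracket.exists_coordinates`), every surviving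
term is a Cauchy determinant (`exists_det_inv_pairing`). Divided by the μ = 0 term, apart from the
factors containing c, it becomes a ratio of products over arithmetic progressions; these ratios are
the factors of the summand of Φ_γ with parameters c, -c, (δ/2 + x_i + α_i δ, δ/2 - x_i). This gives
`GenericPair.exists_phi_eq`.

At c = z_l the factor [z_l - c]_{μ_l} kills every term with μ_l ≠ 0, and what remains is a Φ in the
other variables with parameters z_l, -z_l - γ_l δ (`Phi_sourceParams_self`). The choices c = v and c
= u give the two sides. All this requires generic variables; the general case follows by continuity
along a line of perturbations. -/

/-! ### The Cauchy determinant for a determinantal pairing. -/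

/-- A product of binary linear forms is a binary form, with coefficients independent of the
point at which it is evaluated. -/
lemma exists_coeff_prod_linear_forms {κ : Type*} (s : Finset κ) (f g : κ → ℂ) :
    ∃ K : ℕ → ℂ, ∀ A B : ℂ,
      ∏ k ∈ s, (A * g k - f k * B) = ∑ m ∈ range (#s + 1), A ^ m * B ^ (#s - m) * K m := by
  classical
  induction s using Finset.induction_on with
  | empty => exact ⟨fun _ => 1, fun A B => by simp⟩
  | insert k s hk ih =>
    obtain ⟨K, hK⟩ := ih
    refine ⟨fun m => (if m = 0 then 0 else g k * K (m - 1))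
      - (if m = #s + 1 then 0 else f k * K m), fun A B => ?_⟩
    rw [prod_insert hk, hK, card_insert_of_notMem hk]
    simp only [mul_sub, sum_sub_distrib]
    rw [sum_range_succ' _ (#s + 1), sum_range_succ _ (#s + 1), sub_mul, mul_sum, mul_sum]
    simp only [Nat.add_eq_zero_iff, one_ne_zero, and_false, if_false, if_true, mul_zero, add_zero,
      Nat.add_sub_cancel]
    congr 1
    · refine sum_congr rfl fun m hm => ?_
      rw [Nat.add_sub_add_right]
      ring
    · refine sum_congr rfl fun m hm => ?_
      have hm' : m < #s + 1 := mem_range.1 hm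
      rw [if_neg hm'.ne, Nat.sub_add_comm (by omega)]
      ring

/-- The Cauchy determinant for the entries `1 / r(a_i, X_j)`, where `r` is the determinant pairing
of points of the plane, up to a nonzero factor that does not depend on the `a_i`. -/
lemma exists_det_inv_pairing {P : Type*} (f g : P → ℂ) {ι : Type*} [Fintype ι] [LinearOrder ι]
    (r : P → P → ℂ) (hr : ∀ p q, r p q = f p * g q - f q * g p)
    (X : ι → P) (hX : ∀ i j, i ≠ j → r (X i) (X j) ≠ 0) :
    ∃ κ : ℂ, κ ≠ 0 ∧ ∀ a : ι → P, (∀ i j, r (a i) (X j) ≠ 0) →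
      (Matrix.of fun i j => (r (a i) (X j))⁻¹).det
        = κ * (∏ i, ∏ j, if i < j then r (a j) (a i) else 1) * ∏ i, ∏ j, (r (a i) (X j))⁻¹ := by
  obtain ⟨d, hd⟩ : ∃ d, Fintype.card ι = d := ⟨_, rfl⟩
  let e : Fin d ≃o ι := Fintype.orderIsoFinOfCardEq ι hd
  choose K hK using fun j : ι =>
    exists_coeff_prod_linear_forms (univ.erase j) (fun k => f (X k)) (fun k => g (X k))
  have hcard (j : ι) : #(univ.erase j) + 1 = d := by
    rw [card_erase_of_mem (mem_univ j), card_univ, hd]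
    have : 0 < Fintype.card ι := Fintype.card_pos_iff.2 ⟨j⟩
    omega
  -- Column j of the matrix with entries ∏_{k ≠ j} r(a_i, X_k) is a form of degree d - 1 in (f(a_i),
  -- g(a_i)); `C` collects the coefficients, which depend only on X, and what is left is a
  -- homogeneous Vandermonde matrix.
  let C : Matrix (Fin d) (Fin d) ℂ := Matrix.of fun m j => K (e j) m
  have hprod (a : ι → P) : (Matrix.of fun i j : ι => ∏ k ∈ univ.erase j, r (a i) (X k)).submatrix e e
      = Matrix.projVandermonde (fun i => f (a (e i))) (fun i => g (a (e i))) * C := by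
    ext i j
    simp only [Matrix.submatrix_apply, Matrix.of_apply, hr]
    rw [hK, hcard, Matrix.mul_apply, ← Fin.sum_univ_eq_sum_range
      (fun m => f (a (e i)) ^ m * g (a (e i)) ^ (#(univ.erase (e j)) - m) * K (e j) m) d]
    refine sum_congr rfl fun m _ => ?_
    rw [Matrix.projVandermonde_apply, Fin.val_rev]
    have := hcard (e j)
    rw [show d - (m + 1) = #(univ.erase (e j)) - m by omega]
    rfl
  have hdet (a : ι → P) : (Matrix.of fun i j : ι => ∏ k ∈ univ.erase j, r (a i) (X k)).det
      = (∏ i, ∏ j, if i < j then r (a j) (a i) else 1) * C.det := by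
    rw [← Matrix.det_submatrix_equiv_self e.toEquiv]
    refine (congrArg Matrix.det (hprod a)).trans ?_
    rw [Matrix.det_mul, Matrix.det_projVandermonde]
    congr 1
    rw [← e.toEquiv.prod_comp]
    refine prod_congr rfl fun i _ => ?_
    rw [← e.toEquiv.prod_comp, ← prod_filter]
    refine prod_congr ?_ fun j _ => ?_
    · ext j
      simp
    · rw [hr]
      simp
  refine ⟨C.det, ?_, fun a ha => ?_⟩
  -- Taking a = X makes the matrix diagonal, because r(p, p) = 0; its nonzero determinant forces det
  -- C ≠ 0.
  · have hdiag : (Matrix.of fun i j : ι => ∏ k ∈ univ.erase j, r (X i) (X k))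
        = Matrix.diagonal fun i => ∏ k ∈ univ.erase i, r (X i) (X k) := by
      ext i j
      rcases eq_or_ne i j with rfl | hij
      · simp
      · rw [Matrix.diagonal_apply_ne _ hij]
        exact prod_eq_zero (mem_erase.2 ⟨hij, mem_univ i⟩) (by rw [hr]; ring)
    have h := hdet X
    rw [hdiag, Matrix.det_diagonal] at h
    intro h0
    rw [h0, mul_zero] at h
    refine prod_ne_zero_iff.2 (fun i _ => prod_ne_zero_iff.2 fun k hk => ?_) h
    exact hX i k (mem_erase.1 hk).1.symm
  · have hmat : (Matrix.of fun i j : ι => (r (a i) (X j))⁻¹)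
        = Matrix.of fun i j => (∏ k, (r (a i) (X k))⁻¹)
            * (Matrix.of fun i j : ι => ∏ k ∈ univ.erase j, r (a i) (X k)) i j := by
      ext i j
      simp only [Matrix.of_apply]
      rw [← mul_prod_erase univ _ (mem_univ j), mul_assoc, ← prod_mul_distrib,
        prod_congr rfl fun k _ => inv_mul_cancel₀ (ha i k)]
      simp
    rw [hmat, Matrix.det_mul_column, hdet]
    ring

/-! ### Alternating forms on consecutive differences. -/

/-- A set of indices closed under predecessors is an initial segment. -/
lemma exists_fin_forall_lt_iff {d : ℕ} (p : Fin d → Prop)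
    (hp : ∀ i j : Fin d, (j : ℕ) = i + 1 → p j → p i) :
    ∃ m : Fin (d + 1), ∀ j, p j ↔ j.castSucc < m := by
  induction d with
  | zero => exact ⟨0, fun j => j.elim0⟩
  | succ d ih =>
    obtain ⟨m, hm⟩ := ih (fun j => p j.castSucc)
      fun i j hij => hp i.castSucc j.castSucc (by simpa using hij)
    by_cases h : p (Fin.last d)
    · have hall : ∀ j : Fin (d + 1), p j := by
        intro j
        induction j using Fin.reverseInduction with
        | last => exact h
        | cast i hi => exact hp _ i.succ (by simp) hi
      exact ⟨Fin.last _, fun j => by simp [hall j, Fin.castSucc_lt_last]⟩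
    · refine ⟨m.castSucc, fun j => ?_⟩
      induction j using Fin.lastCases with
      | last => simp [h, Fin.le_last]
      | cast j => simpa using hm j

/-- Expansion of an alternating form in blocks of consecutive differences. -/
lemma alternatingMap_consecutive_differences {V : Type*} [AddCommGroup V] [Module ℂ V]
    {κ : Type*} [Fintype κ] [DecidableEq κ] (γ : κ → ℕ)
    (D : V [⋀^(Σ k, Fin (γ k))]→ₗ[ℂ] ℂ) (H : ∀ k, Fin (γ k + 1) → V) :
    D (fun x => H x.1 x.2.succ - H x.1 x.2.castSucc)
      = ∑ μ : (∀ k, Fin (γ k + 1)), (-1 : ℂ) ^ (∑ k, (μ k : ℕ))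
          * D (fun x => H x.1 ((μ x.1).succAbove x.2)) := by
  classical
  -- Taking the lower endpoint in the first μ_k differences of block k and the upper endpoint in the
  -- others uses every vector of the block once, except the one with index μ_k.
  let S : (∀ k, Fin (γ k + 1)) → Finset (Σ k, Fin (γ k)) :=
    fun μ => univ.filter fun x => x.2.castSucc < μ x.1
  have hS (μ) (x) : x ∈ S μ ↔ x.2.castSucc < μ x.1 := by simp [S]
  have hcard (μ : ∀ k, Fin (γ k + 1)) : #(S μ) = ∑ k, (μ k : ℕ) := by
    have : S μ = univ.sigma fun k => univ.filter fun j : Fin (γ k) => j.castSucc < μ k := by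
      ext x; simp [S]
    rw [this, card_sigma]
    refine sum_congr rfl fun k _ => ?_
    simp only [Fin.lt_def, Fin.val_castSucc, Fin.card_filter_val_lt]
    have := (μ k).2
    omega
  have hterm (μ : ∀ k, Fin (γ k + 1)) :
      D ((S μ).piecewise (fun x => -H x.1 x.2.castSucc) (fun x => H x.1 x.2.succ))
      = (-1 : ℂ) ^ (∑ k, (μ k : ℕ)) * D (fun x => H x.1 ((μ x.1).succAbove x.2)) := by
    have : (S μ).piecewise (fun x => -H x.1 x.2.castSucc) (fun x => H x.1 x.2.succ)
        = (S μ).piecewise (fun x => (-1 : ℂ) • H x.1 ((μ x.1).succAbove x.2))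
            (fun x => H x.1 ((μ x.1).succAbove x.2)) := by
      ext x
      by_cases hx : x ∈ S μ
      · rw [piecewise_eq_of_mem _ _ _ hx, piecewise_eq_of_mem _ _ _ hx,
          Fin.succAbove_of_castSucc_lt _ _ ((hS μ x).1 hx), neg_one_smul]
      · rw [piecewise_eq_of_notMem _ _ _ hx, piecewise_eq_of_notMem _ _ _ hx,
          Fin.succAbove_of_le_castSucc _ _ (not_lt.1 fun h => hx ((hS μ x).2 h))]
    rw [this]
    have h := D.toMultilinearMap.map_piecewise_smul (fun _ => (-1 : ℂ))
      (fun x => H x.1 ((μ x.1).succAbove x.2)) (S μ)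
    refine h.trans ?_
    rw [prod_const, hcard, smul_eq_mul]
    rfl
  have hinj : Function.Injective S := by
    intro μ ν h
    funext k
    have hk (j : Fin (γ k)) : j.castSucc < μ k ↔ j.castSucc < ν k := by
      rw [← hS μ ⟨k, j⟩, ← hS ν ⟨k, j⟩, h]
    refine le_antisymm (not_lt.1 fun hlt => ?_) (not_lt.1 fun hlt => ?_)
    · have := (hk ((ν k).castLT (by have := (μ k).2; omega))).1 (by simpa using hlt)
      simp at this
    · have := (hk ((μ k).castLT (by have := (ν k).2; omega))).2 (by simpa using hlt)
      simp at this
  calc D (fun x => H x.1 x.2.succ - H x.1 x.2.castSucc)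
      = D ((fun x => -H x.1 x.2.castSucc) + (fun x => H x.1 x.2.succ)) := by
        congr 1; funext x; simp [sub_eq_neg_add]
    _ = ∑ s : Finset (Σ k, Fin (γ k)),
          D (s.piecewise (fun x => -H x.1 x.2.castSucc) (fun x => H x.1 x.2.succ)) :=
        D.map_add_univ _ _
    _ = ∑ s ∈ univ.image S,
          D (s.piecewise (fun x => -H x.1 x.2.castSucc) (fun x => H x.1 x.2.succ)) := by
        refine (sum_subset (subset_univ _) fun s _ hs => ?_).symm
        by_contra hne
        refine hs ?_
        -- If the lower endpoint is chosen at j = i + 1 and the upper one at i, the same vector H k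
        -- j occurs twice and the term vanishes. Surviving subsets are therefore initial segments in
        -- each block.
        have hex (k : κ) := exists_fin_forall_lt_iff (fun j : Fin (γ k) => (⟨k, j⟩ : Σ k, Fin (γ k)) ∈ s)
          (fun i j hij hj => by
            by_contra hi
            refine hne ?_
            let w : (Σ k, Fin (γ k)) → V :=
              s.piecewise (fun x => H x.1 x.2.castSucc) (fun x => H x.1 x.2.succ)
            have hw : s.piecewise (fun x => -H x.1 x.2.castSucc) (fun x => H x.1 x.2.succ)
                = s.piecewise (fun x => (-1 : ℂ) • w x) w := by
              ext x
              by_cases hx : x ∈ s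
              · simp [w, hx]
              · simp [w, hx]
            rw [hw]
            refine (D.toMultilinearMap.map_piecewise_smul (fun _ => (-1 : ℂ)) w s).trans ?_
            have : D w = 0 := by
              refine D.map_eq_zero_of_eq w (i := ⟨k, i⟩) (j := ⟨k, j⟩) ?_ ?_
              · simp only [w, piecewise_eq_of_notMem _ _ _ hi, piecewise_eq_of_mem _ _ _ hj]
                congr 1
                ext; simp [hij]
              · intro h
                have : i = j := by simpa using h
                rw [this] at hij; omega
            exact (congrArg _ this).trans (smul_zero _))
        choose μ hμ using hex
        exact mem_image.2 ⟨μ, mem_univ _, by ext ⟨k, j⟩; rw [hS]; exact (hμ k j).symm⟩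
    _ = _ := by
        rw [sum_image fun μ _ ν _ h => hinj h]
        exact sum_congr rfl fun μ _ => hterm μ

/-! ### The three-term relation in determinantal form. -/

/-- `[p ± q] = [p + q][p - q]`. -/
def bracketPM (br : ℂ → ℂ) (p q : ℂ) : ℂ := br (p + q) * br (p - q)

namespace IsBracket
variable {br : ℂ → ℂ}

lemma zero (hbr : IsBracket br) : br 0 = 0 := by
  have h := hbr.odd 0
  rw [neg_zero] at h
  linear_combination h / 2

lemma bracketPM_swap (hbr : IsBracket br) (p q : ℂ) : bracketPM br q p = -bracketPM br p q := by
  have h : br (q - p) = -br (p - q) := by rw [← hbr.odd, neg_sub]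
  rw [bracketPM, bracketPM, h, add_comm q p]
  ring

/-- `[p ± q]` is a determinant in homogeneous coordinates. -/
lemma exists_coordinates (hbr : IsBracket br) :
    ∃ f g : ℂ → ℂ, ∀ p q, bracketPM br p q = f p * g q - f q * g p := by
  obtain ⟨w, hw⟩ := hbr.ne_zero
  -- The three-term relation at (u, v) = (w, 0), divided by [w ± 0] = [w]², which is nonzero by the
  -- choice of w.
  refine ⟨fun p => bracketPM br p w / bracketPM br w 0, fun p => bracketPM br p 0, fun p q => ?_⟩
  have h := hbr.riemann p q w 0
  have hw' : bracketPM br w 0 ≠ 0 := by simpa [bracketPM] using hw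
  change bracketPM br p w * bracketPM br q 0 - bracketPM br p 0 * bracketPM br q w
    = bracketPM br p q * bracketPM br w 0 at h
  field_simp
  linear_combination -h

/-- The difference of `[p ± c] / [p ± X]` under `p ↦ p + δ` factorizes. -/
lemma sub_bracketPM_div (hbr : IsBracket br) (δ p c X : ℂ) (h1 : bracketPM br (p + δ) X ≠ 0)
    (h0 : bracketPM br p X ≠ 0) :
    bracketPM br (p + δ) c * (bracketPM br (p + δ) X)⁻¹ - bracketPM br p c * (bracketPM br p X)⁻¹
      = bracketPM br c X * (bracketPM br (p + δ) p
          * (bracketPM br (p + δ) X)⁻¹ * (bracketPM br p X)⁻¹) := by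
  have h := hbr.riemann (p + δ) p c X
  change bracketPM br (p + δ) c * bracketPM br p X - bracketPM br (p + δ) X * bracketPM br p c
    = bracketPM br (p + δ) p * bracketPM br c X at h
  field_simp
  linear_combination h

end IsBracket

/-! ### Shifted products and products over progressions with one point omitted. -/

section ShiftedBracket
variable (br : ℂ → ℂ) (δ : ℂ)

lemma shiftedBracket_add (u : ℂ) (k l : ℕ) :
    shiftedBracket br δ u (k + l) = shiftedBracket br δ u k * shiftedBracket br δ (u + k * δ) l := by
  rw [shiftedBracket, prod_range_add, shiftedBracket, shiftedBracket]
  congr 1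
  refine prod_congr rfl fun j _ => ?_
  congr 1
  push_cast
  ring

@[simp] lemma shiftedBracket_zero (u : ℂ) : shiftedBracket br δ u 0 = 1 := by
  simp [shiftedBracket]

lemma mul_shiftedBracket_add_step (m : ℕ) (a : ℂ) :
    br a * shiftedBracket br δ (a + δ) m = shiftedBracket br δ a m * br (a + m * δ) := by
  have h := shiftedBracket_add br δ a 1 m
  rw [add_comm 1 m, shiftedBracket_add] at h
  simpa [shiftedBracket] using h.symm

lemma prod_fin_eq_shiftedBracket (u : ℂ) (k : ℕ) :
    ∏ j : Fin k, br (u + (j : ℕ) * δ) = shiftedBracket br δ u k :=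
  Fin.prod_univ_eq_prod_range (fun j => br (u + j * δ)) k

lemma prod_range_sub_eq_shiftedBracket (u : ℂ) (k : ℕ) :
    ∏ j ∈ range k, br (u - (j + 1) * δ) = shiftedBracket br δ (u - k * δ) k := by
  rw [shiftedBracket, ← prod_range_reflect]
  refine prod_congr rfl fun j hj => ?_
  have hj' : j < k := mem_range.1 hj
  rw [Nat.sub_sub, Nat.cast_sub (by omega)]
  congr 1
  push_cast
  ring

lemma prod_fin_neg_eq_shiftedBracket (u : ℂ) (k : ℕ) :
    ∏ j : Fin (k + 1), br (u - (j : ℕ) * δ) = shiftedBracket br δ (u - k * δ) (k + 1) := by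
  have h := prod_range_sub_eq_shiftedBracket br δ (u + δ) (k + 1)
  rw [show u + δ - (k + 1 : ℕ) * δ = u - k * δ by push_cast; ring] at h
  rw [Fin.prod_univ_eq_prod_range (fun j => br (u - j * δ)) (k + 1), ← h]
  refine prod_congr rfl fun j _ => ?_
  congr 1
  ring

/-- A product over all indices but one, as two products over ranges. -/
lemma prod_succAbove_eq_prod_range (h : ℕ → ℂ) {d : ℕ} (m : Fin (d + 1)) :
    ∏ i : Fin d, h (m.succAbove i)
      = (∏ j ∈ range m, h j) * ∏ j ∈ range (d - m), h (m + 1 + j) := by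
  have h1 (i : Fin d) : h (m.succAbove i) = if (i : ℕ) < m then h i else h (i + 1) := by
    rw [Fin.succAbove, apply_ite (fun x : Fin (d + 1) => h x)]
    simp [Fin.lt_def]
  have hm : (m : ℕ) + (d - m) = d := by omega
  rw [prod_congr rfl fun i _ => h1 i,
    Fin.prod_univ_eq_prod_range (fun i => if i < (m : ℕ) then h i else h (i + 1)) d]
  trans ∏ i ∈ range (m + (d - m)), if i < (m : ℕ) then h i else h (i + 1)
  · rw [hm]
  rw [prod_range_add]
  congr 1
  · exact prod_congr rfl fun j hj => if_pos (mem_range.1 hj)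
  · refine prod_congr rfl fun j _ => ?_
    rw [if_neg (by omega)]
    congr 1
    omega

lemma prod_succAbove_eq_shiftedBracket (u : ℂ) {d : ℕ} (m : Fin (d + 1)) :
    ∏ i : Fin d, br (u + (m.succAbove i : ℕ) * δ)
      = shiftedBracket br δ u m * shiftedBracket br δ (u + (m + 1) * δ) (d - m) := by
  rw [prod_succAbove_eq_prod_range (fun j => br (u + j * δ)) m]
  congr 1
  refine prod_congr rfl fun j _ => ?_
  congr 1
  push_cast
  ring

/-- Omitting the index `m` instead of `0`. -/
lemma prod_succAbove_mul_shiftedBracket (u : ℂ) {d : ℕ} (m : Fin (d + 1)) :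
    (∏ i : Fin d, br (u + (m.succAbove i : ℕ) * δ)) * shiftedBracket br δ (u + δ) m
      = shiftedBracket br δ u m * shiftedBracket br δ (u + δ) d := by
  have hm : (m : ℕ) + (d - m) = d := by omega
  have h := shiftedBracket_add br δ (u + δ) m (d - m)
  rw [hm, show u + δ + (m : ℕ) * δ = u + ((m : ℕ) + 1) * δ by ring] at h
  rw [prod_succAbove_eq_shiftedBracket, h]
  ring

end ShiftedBracket

/-- No element of `a + ℤδ` is a zero. -/
def ShiftNonvanishing (br : ℂ → ℂ) (δ a : ℂ) : Prop := ∀ j : ℤ, br (a + j * δ) ≠ 0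

namespace ShiftNonvanishing
variable {br : ℂ → ℂ} {δ a : ℂ}

lemma apply_ne (h : ShiftNonvanishing br δ a) (j : ℤ) {b : ℂ} (hb : b = a + j * δ) : br b ≠ 0 := by
  rw [hb]; exact h j

lemma shift (h : ShiftNonvanishing br δ a) (j : ℤ) {b : ℂ} (hb : b = a + j * δ) :
    ShiftNonvanishing br δ b := by
  intro i
  refine h.apply_ne (j + i) ?_
  rw [hb]; push_cast; ring

lemma neg (hbr : IsBracket br) (h : ShiftNonvanishing br δ a) : ShiftNonvanishing br δ (-a) := by
  intro i
  have := h (-i)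
  rw [show -a + i * δ = -(a + (-i : ℤ) * δ) by push_cast; ring, hbr.odd]
  exact neg_ne_zero.2 this

lemma shiftedBracket_ne (h : ShiftNonvanishing br δ a) (k : ℕ) : shiftedBracket br δ a k ≠ 0 :=
  prod_ne_zero_iff.2 fun j _ => h.apply_ne j (by push_cast; rfl)

end ShiftNonvanishing

/-! ### Interaction of a moving point z + mδ with parameters and progressions. -/

section OneVariable
variable {br : ℂ → ℂ} {δ : ℂ}

/-- The interaction of the point `z + mδ` with the parameter `w`. -/
noncomputable def paramFactor (br : ℂ → ℂ) (δ z w : ℂ) (m : ℕ) : ℂ :=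
  shiftedBracket br δ (z + w) m / shiftedBracket br δ (z - w + δ) m

@[simp] lemma paramFactor_zero (z w : ℂ) : paramFactor br δ z w 0 = 1 := by
  simp [paramFactor]

/-- Omitting the point with index `m` instead of `0` from the factors `[z + jδ ± c]`. -/
lemma prod_succAbove_bracketPM (z c : ℂ) {d : ℕ} (m : Fin (d + 1))
    (h1 : shiftedBracket br δ (z + c + δ) m ≠ 0) (h2 : shiftedBracket br δ (z - c + δ) m ≠ 0) :
    ∏ i : Fin d, bracketPM br (z + (m.succAbove i : ℕ) * δ) c
      = shiftedBracketPM br δ (z + δ) c d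
        * (paramFactor br δ z c m * paramFactor br δ z (-c) m) := by
  have e1 := prod_succAbove_mul_shiftedBracket br δ (z + c) m
  have e2 := prod_succAbove_mul_shiftedBracket br δ (z - c) m
  have h : ∏ i : Fin d, bracketPM br (z + (m.succAbove i : ℕ) * δ) c
      = (∏ i : Fin d, br (z + c + (m.succAbove i : ℕ) * δ))
        * ∏ i : Fin d, br (z - c + (m.succAbove i : ℕ) * δ) := by
    rw [← prod_mul_distrib]
    refine prod_congr rfl fun i _ => ?_
    rw [bracketPM]
    congr 2 <;> ring
  rw [h, shiftedBracketPM, paramFactor, paramFactor, ← sub_eq_add_neg, sub_neg_eq_add,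
    show z + δ + c = z + c + δ by ring,
    show z + δ - c = z - c + δ by ring]
  rw [div_mul_div_comm, ← mul_div_assoc, eq_div_iff (mul_ne_zero h2 h1)]
  linear_combination (shiftedBracket br δ (z - c + δ) m *
    ∏ i : Fin d, br (z - c + (m.succAbove i : ℕ) * δ)) * e1 +
    (shiftedBracket br δ (z + c) m * shiftedBracket br δ (z + c + δ) d) * e2

/-- The interaction of the point `z + mδ` with the points `w, w + δ, …, w + dδ`. -/
noncomputable def crossFactor (br : ℂ → ℂ) (δ z w : ℂ) (d m : ℕ) : ℂ :=
  (shiftedBracket br δ (z + w) m * shiftedBracket br δ (z - w - d * δ) m)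
    / (shiftedBracket br δ (z + w + (d + 1) * δ) m * shiftedBracket br δ (z - w + δ) m)

/-- Moving z to z + mδ slides the two progressions formed by the sums and the differences; the
overlaps cancel and the m-fold shifted products at the ends make up `crossFactor`. -/
lemma prod_bracketPM_eq_crossFactor_mul {z w : ℂ} (hadd : ShiftNonvanishing br δ (z + w))
    (hsub : ShiftNonvanishing br δ (z - w)) (d m : ℕ) :
    ∏ j : Fin (d + 1), bracketPM br z (w + (j : ℕ) * δ)
      = crossFactor br δ z w d m * ∏ j : Fin (d + 1), bracketPM br (z + m * δ) (w + (j : ℕ) * δ) := by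
  have key (a : ℂ) (b : ℂ) : ∏ j : Fin (d + 1), bracketPM br (a + b) (w + (j : ℕ) * δ)
      = shiftedBracket br δ (a + b + w) (d + 1) * shiftedBracket br δ (a + b - w - d * δ) (d + 1) := by
    rw [← prod_fin_eq_shiftedBracket, ← prod_fin_neg_eq_shiftedBracket, ← prod_mul_distrib]
    refine prod_congr rfl fun i _ => ?_
    rw [bracketPM]
    congr 2 <;> ring
  have k0 := key z 0
  rw [add_zero] at k0
  rw [k0, key, crossFactor]
  have e1 : shiftedBracket br δ (z + w) (d + 1) * shiftedBracket br δ (z + w + (d + 1) * δ) m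
      = shiftedBracket br δ (z + w) m * shiftedBracket br δ (z + m * δ + w) (d + 1) := by
    have h1 := shiftedBracket_add br δ (z + w) (d + 1) m
    have h2 := shiftedBracket_add br δ (z + w) m (d + 1)
    rw [add_comm m, h1, Nat.cast_add, Nat.cast_one] at h2
    rw [h2]
    congr 2; ring
  have e2 : shiftedBracket br δ (z - w - d * δ) (d + 1) * shiftedBracket br δ (z - w + δ) m
      = shiftedBracket br δ (z - w - d * δ) m
        * shiftedBracket br δ (z + m * δ - w - d * δ) (d + 1) := by
    have h1 := shiftedBracket_add br δ (z - w - d * δ) (d + 1) m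
    have h2 := shiftedBracket_add br δ (z - w - d * δ) m (d + 1)
    rw [add_comm m, h1, Nat.cast_add, Nat.cast_one] at h2
    rw [show z - w + δ = z - w - d * δ + (d + 1) * δ by ring, h2]
    congr 2; ring
  have n1 := (hadd.shift (d + 1) (b := z + w + (d + 1) * δ) (by push_cast; ring)).shiftedBracket_ne m
  have n2 := (hsub.shift 1 (b := z - w + δ) (by push_cast; ring)).shiftedBracket_ne m
  rw [div_mul_eq_mul_div, eq_div_iff (mul_ne_zero n1 n2)]
  linear_combination (shiftedBracket br δ (z - w - d * δ) (d + 1)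
      * shiftedBracket br δ (z - w + δ) m) * e1
    + (shiftedBracket br δ (z + w) m * shiftedBracket br δ (z + m * δ + w) (d + 1)) * e2

/-- The interaction of the point `z + mδ` with the other points among `z, z + δ, …, z + dδ`. -/
lemma prod_succAbove_zero_bracketPM_self {z : ℂ}
    (hδ : ∀ k : ℤ, br (k * δ) = 0 → k = 0) (h2 : ShiftNonvanishing br δ (2 * z)) {d : ℕ}
    (m : Fin (d + 1)) :
    ∏ i : Fin d, bracketPM br z (z + ((0 : Fin (d + 1)).succAbove i : ℕ) * δ)
      = br (2 * z + 2 * m * δ) / br (2 * z) * crossFactor br δ z z d m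
        * ∏ i : Fin d, bracketPM br (z + (m : ℕ) * δ) (z + (m.succAbove i : ℕ) * δ) := by
  have split (a : ℕ) (i : Fin (d + 1)) :
      ∏ j : Fin d, bracketPM br (z + a * δ) (z + (i.succAbove j : ℕ) * δ)
      = (∏ j : Fin d, br (2 * z + a * δ + (i.succAbove j : ℕ) * δ))
        * ∏ j : Fin d, br (a * δ - (i.succAbove j : ℕ) * δ) := by
    rw [← prod_mul_distrib]
    refine prod_congr rfl fun j _ => ?_
    rw [bracketPM]
    congr 2 <;> ring
  have minus (i : Fin (d + 1)) : ∏ j : Fin d, br ((i : ℕ) * δ - (i.succAbove j : ℕ) * δ)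
      = shiftedBracket br δ δ i * shiftedBracket br δ (-((d : ℂ) * δ) + (i : ℕ) * δ) (d - i) := by
    rw [prod_succAbove_eq_prod_range (fun j => br ((i : ℕ) * δ - j * δ)) i]
    have hi : (i : ℕ) ≤ d := Nat.lt_succ_iff.1 i.2
    have e1 := prod_range_sub_eq_shiftedBracket br δ (((i : ℕ) + 1) * δ) i
    have e2 := prod_range_sub_eq_shiftedBracket br δ 0 (d - i)
    rw [show ((i : ℕ) + 1) * δ - (i : ℕ) * δ = δ by ring] at e1
    rw [Nat.cast_sub hi, show 0 - ((d : ℂ) - (i : ℕ)) * δ = -((d : ℂ) * δ) + (i : ℕ) * δ by ring]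
      at e2
    rw [← e1, ← e2]
    congr 1
    · refine prod_congr rfl fun j _ => ?_
      congr 1; ring
    · refine prod_congr rfl fun j _ => ?_
      congr 1; push_cast; ring
  have hm : (m : ℕ) + (d - m) = d := by omega
  have s0 := split 0 0
  rw [Nat.cast_zero, zero_mul, add_zero, add_zero] at s0
  have m0 := minus 0
  rw [Fin.val_zero, Nat.cast_zero, zero_mul, shiftedBracket_zero, one_mul, add_zero, Nat.sub_zero]
    at m0
  have m1 := shiftedBracket_add br δ (-((d : ℂ) * δ)) m (d - m)
  rw [hm] at m1
  have p0 := prod_succAbove_eq_shiftedBracket br δ (2 * z) (0 : Fin (d + 1))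
  rw [Fin.val_zero, Nat.cast_zero, zero_add, one_mul, shiftedBracket_zero, one_mul, Nat.sub_zero]
    at p0
  have pm := prod_succAbove_mul_shiftedBracket br δ (2 * z + (m : ℕ) * δ) m
  have q1 : shiftedBracket br δ (2 * z + δ) d * shiftedBracket br δ (2 * z + (d + 1) * δ) m
      = shiftedBracket br δ (2 * z + δ) m * shiftedBracket br δ (2 * z + (m : ℕ) * δ + δ) d := by
    have h1 := shiftedBracket_add br δ (2 * z + δ) d m
    have h3 := shiftedBracket_add br δ (2 * z + δ) m d
    rw [add_comm (m : ℕ), h1] at h3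
    convert h3 using 3 <;> ring
  -- Two moves by m steps, from [2z] to [2z + mδ] and on to [2z + 2mδ], produce the factor [2z +
  -- 2mδ]/[2z].
  have q2 := mul_shiftedBracket_add_step br δ m (2 * z)
  have q3 := mul_shiftedBracket_add_step br δ m (2 * z + (m : ℕ) * δ)
  rw [show 2 * z + (m : ℕ) * δ + (m : ℕ) * δ = 2 * z + 2 * (m : ℕ) * δ by ring] at q3
  have n1 := (h2.shift (d + 1) (b := 2 * z + (d + 1) * δ) (by push_cast; ring)).shiftedBracket_ne m
  have n2 := (h2.shift (m + 1) (b := 2 * z + (m : ℕ) * δ + δ)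
    (by push_cast; ring)).shiftedBracket_ne m
  -- Here ℤδ ∩ Ω = {0} enters: [(j + 1)δ] = 0 would force j + 1 = 0.
  have n3 : shiftedBracket br δ δ m ≠ 0 := by
    refine prod_ne_zero_iff.2 fun j _ h0 => ?_
    have := hδ (j + 1) (by rw [← h0]; congr 1; push_cast; ring)
    omega
  have n4 : br (2 * z) ≠ 0 := h2.apply_ne 0 (by simp)
  rw [crossFactor, ← two_mul, sub_self, zero_sub, zero_add, s0, p0, m0, m1, split, minus,
    div_mul_div_comm, div_mul_eq_mul_div, eq_div_iff (mul_ne_zero n4 (mul_ne_zero n1 n3))]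
  refine mul_right_cancel₀ n2 ?_
  generalize shiftedBracket br δ (-((d : ℂ) * δ)) m = A at *
  generalize shiftedBracket br δ (-((d : ℂ) * δ) + (m : ℕ) * δ) (d - m) = B at *
  generalize shiftedBracket br δ δ m = C at *
  generalize shiftedBracket br δ (2 * z + (m : ℕ) * δ + δ) m = E at *
  generalize shiftedBracket br δ (2 * z + (m : ℕ) * δ + δ) d = F at *
  generalize shiftedBracket br δ (2 * z + (m : ℕ) * δ) m = G at *
  generalize shiftedBracket br δ (2 * z + (d + 1) * δ) m = I at *
  generalize shiftedBracket br δ (2 * z + δ) m = J at *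
  generalize shiftedBracket br δ (2 * z + δ) d = K at *
  generalize shiftedBracket br δ (2 * z) m = L at *
  generalize br (2 * z) = b0 at *
  generalize br (2 * z + (m : ℕ) * δ) = b1 at *
  generalize br (2 * z + 2 * (m : ℕ) * δ) = b2 at *
  generalize (∏ i : Fin d, br (2 * z + (m : ℕ) * δ + (m.succAbove i : ℕ) * δ)) = P at *
  linear_combination (A * B * C * b0 * E) * q1 + (A * B * C * E * F) * q2
    + (A * B * C * L * F) * q3 - (A * B * C * b2 * L) * pm

end OneVariable

/-! ### Vandermonde products of blocks with one point omitted from each. -/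

/-- A product over the lexicographically ordered pairs of a sigma type, block by block. -/
lemma prod_lex_pairs {L : ℕ} (γ : Fin L → ℕ) (F : (Σ k, Fin (γ k)) → (Σ k, Fin (γ k)) → ℂ) :
    (∏ x : (Σₗ k, Fin (γ k)), ∏ y : (Σₗ k, Fin (γ k)), if x < y then F (ofLex x) (ofLex y) else 1)
      = (∏ k, ∏ i : Fin (γ k), ∏ j : Fin (γ k), if i < j then F ⟨k, i⟩ ⟨k, j⟩ else 1)
        * ∏ k, ∏ l, if k < l then ∏ i : Fin (γ k), ∏ j : Fin (γ l), F ⟨k, i⟩ ⟨l, j⟩ else 1 := by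
  let q (k : Fin L) (i : Fin (γ k)) : Σₗ k, Fin (γ k) := toLex ⟨k, i⟩
  have hlt {k l : Fin L} (hkl : k ≠ l) (i : Fin (γ k)) (j : Fin (γ l)) :
      q k i < q l j ↔ k < l := by
    rw [Sigma.Lex.lt_def]
    exact ⟨fun h => h.resolve_right fun ⟨h, _⟩ => hkl h, Or.inl⟩
  have hlt' {k : Fin L} (i j : Fin (γ k)) : q k i < q k j ↔ i < j := by
    rw [Sigma.Lex.lt_def]
    exact ⟨fun h => (h.resolve_left (lt_irrefl _)).2, fun h => Or.inr ⟨rfl, h⟩⟩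
  have hsig (f : (Σₗ k, Fin (γ k)) → ℂ) : ∏ x, f x = ∏ k, ∏ i : Fin (γ k), f (q k i) :=
    Fintype.prod_sigma (fun x : (Σ k, Fin (γ k)) => f (toLex x))
  rw [hsig, ← prod_mul_distrib]
  refine prod_congr rfl fun k _ => ?_
  have hinner (i : Fin (γ k)) : (∏ y : (Σₗ k, Fin (γ k)), if q k i < y then
      F (ofLex (q k i)) (ofLex y) else 1) = (∏ j : Fin (γ k), if i < j then F ⟨k, i⟩ ⟨k, j⟩ else 1)
        * ∏ l, if k < l then ∏ j : Fin (γ l), F ⟨k, i⟩ ⟨l, j⟩ else 1 := by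
    rw [hsig, ← mul_prod_erase univ _ (mem_univ k),
      ← mul_prod_erase univ (fun l => if k < l then _ else _) (mem_univ k), if_neg (lt_irrefl k),
      one_mul]
    congr 1
    · exact prod_congr rfl fun j _ => by simp only [hlt']; rfl
    · refine prod_congr rfl fun l hl => ?_
      have hkl : k ≠ l := (mem_erase.1 hl).1.symm
      by_cases h : k < l
      · simp only [hlt hkl, h, if_true]; rfl
      · simp [hlt hkl, h]
  rw [prod_congr rfl fun i _ => hinner i, prod_mul_distrib]
  congr 1
  rw [prod_comm]
  refine prod_congr rfl fun l _ => ?_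
  by_cases h : k < l <;> simp [h]

/-- The Vandermonde-type product after omitting one point. -/
lemma prod_pairs_succAbove (R : ℕ → ℕ → ℂ) (hR : ∀ i j, R j i = -R i j) {d : ℕ}
    (m : Fin (d + 1)) :
    (-1) ^ (m : ℕ) * (∏ i : Fin d, ∏ j : Fin d,
        if i < j then R (m.succAbove j) (m.succAbove i) else 1)
      * ∏ i : Fin d, R m (m.succAbove i)
      = (-1) ^ d * ∏ i : Fin (d + 1), ∏ j : Fin (d + 1), if i < j then R j i else 1 := by
  have hinner (i : Fin d) : (∏ j : Fin (d + 1), if m.succAbove i < j then R j (m.succAbove i) else 1)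
      = (if m.succAbove i < m then R m (m.succAbove i) else 1)
        * ∏ j : Fin d, if i < j then R (m.succAbove j) (m.succAbove i) else 1 := by
    rw [Fin.prod_univ_succAbove _ m]
    simp only [Fin.succAbove_lt_succAbove_iff]
  rw [Fin.prod_univ_succAbove _ m, Fin.prod_univ_succAbove _ m, prod_congr rfl fun i _ => hinner i,
    prod_mul_distrib, if_neg (lt_irrefl m), one_mul]
  -- (-1)^m gives one sign for each index below m, and antisymmetry gives one for each index above
  -- m. The total (-1)^d does not depend on m, so the sign of the alternating expansion disappears.
  have hsign : (-1 : ℂ) ^ (m : ℕ) = ∏ i : Fin d, if m.succAbove i < m then (-1 : ℂ) else 1 := by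
    have := Fin.card_filter_val_lt (n := d) (m := m)
    rw [min_eq_right (Nat.lt_succ_iff.1 m.2)] at this
    simp only [Fin.succAbove_lt_iff_castSucc_lt]
    rw [prod_ite, prod_const_one, prod_const, mul_one]
    simp only [Fin.lt_def, Fin.val_castSucc, this]
  have hd : (-1 : ℂ) ^ d = ∏ _i : Fin d, (-1 : ℂ) := by simp
  have hkey : (-1 : ℂ) ^ (m : ℕ) * ∏ i : Fin d, R m (m.succAbove i)
      = (-1) ^ d * ((∏ j : Fin d, if m < m.succAbove j then R (m.succAbove j) m else 1)
        * ∏ i : Fin d, if m.succAbove i < m then R m (m.succAbove i) else 1) := by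
    rw [hsign, hd, ← prod_mul_distrib, ← prod_mul_distrib, ← prod_mul_distrib]
    refine prod_congr rfl fun i _ => ?_
    rcases lt_or_gt_of_ne (Fin.succAbove_ne m i) with h | h
    · rw [if_pos h, if_neg h.not_gt, if_pos h]; ring
    · rw [if_neg h.not_gt, if_pos h, if_neg h.not_gt, hR m]; ring
  linear_combination (∏ i : Fin d, ∏ j : Fin d,
        if i < j then R (m.succAbove j) (m.succAbove i) else 1) * hkey

/-- The product over a rectangle after omitting one row and one column. -/
lemma prod_rectangle_succAbove (R : ℕ → ℕ → ℂ) {d e : ℕ} (m : Fin (d + 1)) (n : Fin (e + 1)) :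
    (∏ i : Fin (d + 1), ∏ j : Fin (e + 1), R i j) * R m n
      = (∏ j : Fin (e + 1), R m j) * (∏ i : Fin (d + 1), R i n)
        * ∏ i : Fin d, ∏ j : Fin e, R (m.succAbove i) (n.succAbove j) := by
  have h (i : Fin d) : ∏ j : Fin (e + 1), R (m.succAbove i) j
      = R (m.succAbove i) n * ∏ j : Fin e, R (m.succAbove i) (n.succAbove j) :=
    Fin.prod_univ_succAbove _ n
  rw [Fin.prod_univ_succAbove (fun i : Fin (d + 1) => ∏ j : Fin (e + 1), R i j) m,
    Fin.prod_univ_succAbove (fun i : Fin (d + 1) => R i n) m, prod_congr rfl fun i _ => h i,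
    prod_mul_distrib]
  ring

section
variable {br : ℂ → ℂ} {δ : ℂ}

/-- Genericity of the variables `z` with respect to shifts by multiples of `δ`. -/
structure GenericVars (br : ℂ → ℂ) (δ : ℂ) {L : ℕ} (z : Fin L → ℂ) : Prop where
  step : ∀ k : ℤ, br (k * δ) = 0 → k = 0
  two_mul : ∀ k, ShiftNonvanishing br δ (2 * z k)
  add : ∀ k l, k ≠ l → ShiftNonvanishing br δ (z k + z l)
  sub : ∀ k l, k ≠ l → ShiftNonvanishing br δ (z k - z l)

/-- The alternating sum whose terms are the Cauchy determinants of the shifted points depends on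
`c` only through a product over the columns. -/
lemma exists_sum_det_eq (hbr : IsBracket br) {L : ℕ} (γ : Fin L → ℕ) (z : Fin L → ℂ)
    (X : (Σ k, Fin (γ k)) → ℂ)
    (hX : ∀ k (j : ℕ) y, bracketPM br (z k + j * δ) (X y) ≠ 0) :
    ∃ D₀ : ℂ, ∀ c : ℂ, ∑ μ : (∀ k, Fin (γ k + 1)), (-1 : ℂ) ^ (∑ k, (μ k : ℕ))
      * ((∏ x : (Σ k, Fin (γ k)), bracketPM br (z x.1 + ((μ x.1).succAbove x.2 : ℕ) * δ) c)
        * (Matrix.of fun x y : (Σ k, Fin (γ k)) =>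
            (bracketPM br (z x.1 + ((μ x.1).succAbove x.2 : ℕ) * δ) (X y))⁻¹).det)
      = (∏ y, bracketPM br c (X y)) * D₀ := by
  -- The differences of rows with the column factor [c ± X_y] removed; no c is left.
  let A : Matrix (Σ k, Fin (γ k)) (Σ k, Fin (γ k)) ℂ := Matrix.of fun x y =>
    bracketPM br (z x.1 + (x.2 : ℕ) * δ + δ) (z x.1 + (x.2 : ℕ) * δ)
      * (bracketPM br (z x.1 + (x.2 : ℕ) * δ + δ) (X y))⁻¹
      * (bracketPM br (z x.1 + (x.2 : ℕ) * δ) (X y))⁻¹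
  refine ⟨A.det, fun c => ?_⟩
  have h := alternatingMap_consecutive_differences γ
    (Matrix.detRowAlternating (n := Σ k, Fin (γ k)) (R := ℂ))
    (fun k j y => bracketPM br (z k + (j : ℕ) * δ) c * (bracketPM br (z k + (j : ℕ) * δ) (X y))⁻¹)
  trans Matrix.det (fun x y => bracketPM br c (X y) * A x y)
  · trans
    swap
    · refine h.symm.trans ?_
      refine congrArg Matrix.det ?_
      funext x y
      have hs : z x.1 + (x.2.succ : ℕ) * δ = z x.1 + (x.2 : ℕ) * δ + δ := by
        rw [Fin.val_succ]; push_cast; ring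
      have h1 := hX x.1 (x.2 + 1) y
      rw [show z x.1 + (x.2 + 1 : ℕ) * δ = z x.1 + (x.2 : ℕ) * δ + δ by push_cast; ring] at h1
      have := hbr.sub_bracketPM_div δ (z x.1 + (x.2 : ℕ) * δ) c (X y) h1 (hX x.1 x.2 y)
      rw [← hs] at this
      refine Eq.trans ?_ (this.trans ?_)
      · rfl
      · rw [hs]; rfl
    · refine sum_congr rfl fun μ _ => ?_
      rw [← Matrix.det_mul_column]
      rfl
  · exact Matrix.det_mul_row _ A

/-- By `prod_pairs_succAbove` the reduced Vandermonde product times the interaction of the omitted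
point with the rest is, up to the sign (-1)^m, the same for omission of m and of 0. So only the two
interactions have to be compared, which is `prod_succAbove_zero_bracketPM_self`. -/
lemma GenericVars.prod_pairs_block {L : ℕ} {z : Fin L → ℂ} (hz : GenericVars br δ z)
    (hbr : IsBracket br) (k : Fin L) {d : ℕ} (m : Fin (d + 1)) :
    (-1) ^ (m : ℕ) * (∏ i : Fin d, ∏ j : Fin d, if i < j then
        bracketPM br (z k + (m.succAbove j : ℕ) * δ) (z k + (m.succAbove i : ℕ) * δ) else 1)
      = (∏ i : Fin d, ∏ j : Fin d, if i < j then
        bracketPM br (z k + ((0 : Fin (d + 1)).succAbove j : ℕ) * δ)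
          (z k + ((0 : Fin (d + 1)).succAbove i : ℕ) * δ) else 1)
        * (br (2 * z k + 2 * m * δ) / br (2 * z k) * crossFactor br δ (z k) (z k) d m) := by
  have hself := prod_succAbove_zero_bracketPM_self hz.step (hz.two_mul k) m
  have e := fun m : Fin (d + 1) => prod_pairs_succAbove
    (fun i j => bracketPM br (z k + i * δ) (z k + j * δ)) (fun i j => hbr.bracketPM_swap _ _) m
  have h0 := (e m).trans (e 0).symm
  simp only [Fin.val_zero, Nat.cast_zero, zero_mul, add_zero, pow_zero, one_mul] at h0
  have hQ : ∏ i : Fin d, bracketPM br (z k + (m : ℕ) * δ) (z k + (m.succAbove i : ℕ) * δ) ≠ 0 := by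
    refine prod_ne_zero_iff.2 fun i _ => mul_ne_zero ?_ fun h => ?_
    · exact (hz.two_mul k).apply_ne (m + (m.succAbove i : ℕ)) (by push_cast; ring)
    · have := hz.step (m - (m.succAbove i : ℕ)) (by rw [← h]; congr 1; push_cast; ring)
      exact Fin.succAbove_ne m i (Fin.ext (by omega))
  refine mul_right_cancel₀ hQ (h0.trans ?_)
  rw [hself]
  ring

/-- Inclusion–exclusion: the full rectangle does not depend on (m, n), and a reduced one is the full
one divided by a row and a column and multiplied by their common corner. Compared with (0, 0), row
and column give the two cross factors and the corner gives the quotient of brackets. -/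
lemma GenericVars.prod_rectangle_block {L : ℕ} {z : Fin L → ℂ} (hz : GenericVars br δ z)
    (hbr : IsBracket br) {k l : Fin L} (hkl : k ≠ l) {d e : ℕ} (m : Fin (d + 1))
    (n : Fin (e + 1)) :
    (∏ i : Fin d, ∏ j : Fin e,
        bracketPM br (z l + (n.succAbove j : ℕ) * δ) (z k + (m.succAbove i : ℕ) * δ))
      = (∏ i : Fin d, ∏ j : Fin e, bracketPM br (z l + ((0 : Fin (e + 1)).succAbove j : ℕ) * δ)
          (z k + ((0 : Fin (d + 1)).succAbove i : ℕ) * δ))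
        * (bracketPM br (z k + m * δ) (z l + n * δ) / bracketPM br (z k) (z l)
          * (crossFactor br δ (z k) (z l) e m * crossFactor br δ (z l) (z k) d n)) := by
  have hne (i j : ℕ) : bracketPM br (z l + j * δ) (z k + i * δ) ≠ 0 :=
    mul_ne_zero ((hz.add l k hkl.symm).apply_ne (j + i) (by push_cast; ring))
      ((hz.sub l k hkl.symm).apply_ne (j - i) (by push_cast; ring))
  have e1 := prod_bracketPM_eq_crossFactor_mul (hz.add k l hkl) (hz.sub k l hkl) e m
  have e2 := prod_bracketPM_eq_crossFactor_mul (hz.add l k hkl.symm) (hz.sub l k hkl.symm) d n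
  have hswap (p q : ℂ) := hbr.bracketPM_swap p q
  have e1' : ∏ j : Fin (e + 1), bracketPM br (z l + (j : ℕ) * δ) (z k)
      = crossFactor br δ (z k) (z l) e m
        * ∏ j : Fin (e + 1), bracketPM br (z l + (j : ℕ) * δ) (z k + m * δ) := by
    simp only [fun j : Fin (e + 1) => hswap (z k) (z l + (j : ℕ) * δ),
      fun j : Fin (e + 1) => hswap (z k + m * δ) (z l + (j : ℕ) * δ), prod_neg, e1]
    ring
  have r1 := prod_rectangle_succAbove (fun i j => bracketPM br (z l + j * δ) (z k + i * δ)) m n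
  have r0 := prod_rectangle_succAbove (fun i j => bracketPM br (z l + j * δ) (z k + i * δ))
    (0 : Fin (d + 1)) (0 : Fin (e + 1))
  simp only [Fin.val_zero, Nat.cast_zero, zero_mul, add_zero] at r0
  rw [e1', e2] at r0
  have hA : ∏ j : Fin (e + 1), bracketPM br (z l + (j : ℕ) * δ) (z k + (m : ℕ) * δ) ≠ 0 :=
    prod_ne_zero_iff.2 fun j _ => hne m j
  have hB : ∏ i : Fin (d + 1), bracketPM br (z l + (n : ℕ) * δ) (z k + (i : ℕ) * δ) ≠ 0 :=
    prod_ne_zero_iff.2 fun i _ => hne i n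
  have h00 : bracketPM br (z k) (z l) ≠ 0 := by
    have := hne 0 0
    rw [hswap] at this
    simpa using this
  rw [hswap (z k)] at r0
  rw [hswap (z k + (m : ℕ) * δ)] at r1
  refine mul_left_cancel₀ (mul_ne_zero (mul_ne_zero hA hB) h00) ?_
  rw [div_mul_eq_mul_div, mul_div_assoc', mul_div_assoc', eq_div_iff h00]
  linear_combination (-bracketPM br (z k) (z l)^2) * r1
    + bracketPM br (z k) (z l) * bracketPM br (z k + m * δ) (z l + n * δ) * r0

end

lemma prod_diag_mul_prod_pairs {L : ℕ} (S : Fin L → Fin L → ℂ) :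
    (∏ k, S k k) * ∏ k, ∏ l, (if k < l then S k l * S l k else 1) = ∏ k, ∏ l, S k l := by
  have h1 : ∏ k, S k k = ∏ k, ∏ l, if k = l then S k l else 1 :=
    prod_congr rfl fun k _ => by rw [prod_ite_eq, if_pos (mem_univ k)]
  have h2 : ∏ k, ∏ l, (if k < l then S k l * S l k else 1)
      = (∏ k, ∏ l, if k < l then S k l else 1) * ∏ k, ∏ l, if l < k then S k l else 1 := by
    rw [prod_comm (f := fun k l => if l < k then S k l else 1), ← prod_mul_distrib]
    refine prod_congr rfl fun k _ => ?_
    rw [← prod_mul_distrib]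
    refine prod_congr rfl fun l _ => ?_
    split_ifs <;> simp
  rw [h1, h2, ← prod_mul_distrib, ← prod_mul_distrib]
  refine prod_congr rfl fun k _ => ?_
  rw [← prod_mul_distrib, ← prod_mul_distrib]
  refine prod_congr rfl fun l _ => ?_
  rcases lt_trichotomy k l with h | h | h
  · simp [h, h.ne, h.not_gt]
  · simp [h]
  · simp [h, h.ne', h.not_gt]

lemma prod_range_shift_mul (f : ℕ → ℂ) (n : ℕ) :
    (∏ a ∈ range n, f (a + 1)) * f 0 = (∏ a ∈ range n, f a) * f n := by
  rw [← prod_range_succ', prod_range_succ]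

/-! ### The source identity: Cauchy terms as summands of Φ. -/

section
variable {br : ℂ → ℂ} {δ : ℂ}

/-- The points `x_i + δ/2 + jδ`, `j < α_i`. -/
noncomputable def columnPoint (δ : ℂ) {m : ℕ} (α : Fin m → ℕ) (x : Fin m → ℂ)
    (y : Σ i, Fin (α i)) : ℂ :=
  x y.1 + δ / 2 + (y.2 : ℕ) * δ

/-- The parameters `c, -c, (δ/2 + x_i + α_i δ, δ/2 - x_i)`. -/
noncomputable def sourceParams (δ : ℂ) {m : ℕ} (α : Fin m → ℕ) (x : Fin m → ℂ) (c : ℂ) :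
    Fin 2 ⊕ (Fin m ⊕ Fin m) → ℂ :=
  Sum.elim ![c, -c] (Sum.elim (fun i => δ / 2 + x i + α i * δ) (fun i => δ / 2 - x i))

/-- The factors of successive column points X and X + δ have the form f(a+1)/f(a) · g(a)/g(a+1), so
a whole progression leaves only its two ends, which are two parameters of Φ. -/
lemma prod_columns_telescope (z x : ℂ) (α m : ℕ) (hadd : ShiftNonvanishing br δ (z + x + δ / 2))
    (hsub : ShiftNonvanishing br δ (z - x + δ / 2)) :
    ∏ a : Fin α, (paramFactor br δ z (x + δ / 2 + (a : ℕ) * δ) m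
      * (paramFactor br δ z (-(x + δ / 2 + (a : ℕ) * δ)) m))⁻¹
    = paramFactor br δ z (δ / 2 + x + α * δ) m
      * (paramFactor br δ z (δ / 2 - x) m) := by
  let f : ℕ → ℂ := fun a => shiftedBracket br δ (z + x + δ / 2 + a * δ) m
  let g : ℕ → ℂ := fun a => shiftedBracket br δ (z - x + δ / 2 - a * δ) m
  have hf (a : ℕ) : f a ≠ 0 := (hadd.shift a (by push_cast; ring)).shiftedBracket_ne m
  have hg (a : ℕ) : g a ≠ 0 := (hsub.shift (-a) (by push_cast; ring)).shiftedBracket_ne m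
  have key (a : Fin α) : (paramFactor br δ z (x + δ / 2 + (a : ℕ) * δ) m
      * (paramFactor br δ z (-(x + δ / 2 + (a : ℕ) * δ)) m))⁻¹
      = f (a + 1) / f a * (g a / g (a + 1)) := by
    have e1 : shiftedBracket br δ (z + (x + δ / 2 + (a : ℕ) * δ)) m = f a := by
      simp only [f]; congr 1; ring
    have e2 : shiftedBracket br δ (z - (x + δ / 2 + (a : ℕ) * δ) + δ) m = g a := by
      simp only [g]; congr 1; ring
    have e3 : shiftedBracket br δ (z + -(x + δ / 2 + (a : ℕ) * δ)) m = g (a + 1) := by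
      simp only [g]; congr 1; push_cast; ring
    have e4 : shiftedBracket br δ (z - -(x + δ / 2 + (a : ℕ) * δ) + δ) m = f (a + 1) := by
      simp only [f]; congr 1; push_cast; ring
    rw [paramFactor, paramFactor, e1, e2, e3, e4, mul_inv, inv_div, inv_div]
    ring
  have e1 : shiftedBracket br δ (z + (δ / 2 + x + α * δ)) m = f α := by
    simp only [f]; congr 1; ring
  have e2 : shiftedBracket br δ (z - (δ / 2 + x + α * δ) + δ) m = g α := by
    simp only [g]; congr 1; ring
  have e3 : shiftedBracket br δ (z + (δ / 2 - x)) m = g 0 := by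
    simp only [g]; congr 1; push_cast; ring
  have e4 : shiftedBracket br δ (z - (δ / 2 - x) + δ) m = f 0 := by
    simp only [f]; congr 1; push_cast; ring
  rw [prod_congr rfl fun a _ => key a, paramFactor, paramFactor, e1, e2, e3, e4,
    Fin.prod_univ_eq_prod_range (fun a => f (a + 1) / f a * (g a / g (a + 1))) α,
    prod_mul_distrib, prod_div_distrib, prod_div_distrib]
  have tf := prod_range_shift_mul f α
  have tg := prod_range_shift_mul g α
  have n1 : ∏ a ∈ range α, f a ≠ 0 := prod_ne_zero_iff.2 fun a _ => hf a
  have n2 : ∏ a ∈ range α, g (a + 1) ≠ 0 := prod_ne_zero_iff.2 fun a _ => hg _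
  rw [(div_eq_div_iff n1 (hf 0)).2 (tf.trans (mul_comm _ _)),
    (div_eq_div_iff n2 (hg α)).2 (tg.symm.trans (mul_comm _ _))]
  field_simp

/-- Genericity of the variables `z` and `x` with respect to each other. -/
structure GenericPair (br : ℂ → ℂ) (δ : ℂ) {L m : ℕ} (z : Fin L → ℂ) (x : Fin m → ℂ) : Prop where
  left : GenericVars br δ z
  right : GenericVars br δ x
  add : ∀ k i, ShiftNonvanishing br δ (z k + x i + δ / 2)
  sub : ∀ k i, ShiftNonvanishing br δ (z k - x i + δ / 2)

namespace GenericPair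
variable {L m : ℕ} {z : Fin L → ℂ} {x : Fin m → ℂ}

lemma bracketPM_columnPoint_ne (h : GenericPair br δ z x) (α : Fin m → ℕ) (k : Fin L) (j : ℕ)
    (y : Σ i, Fin (α i)) : bracketPM br (z k + j * δ) (columnPoint δ α x y) ≠ 0 :=
  mul_ne_zero
    ((h.add k y.1).apply_ne (j + (y.2 : ℕ)) (by rw [columnPoint]; push_cast; ring))
    ((h.sub k y.1).apply_ne (j - (y.2 : ℕ) - 1) (by rw [columnPoint]; push_cast; ring))

lemma bracketPM_columnPoints_ne (h : GenericPair br δ z x) (α : Fin m → ℕ)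
    {y y' : Σ i, Fin (α i)} (hy : y ≠ y') :
    bracketPM br (columnPoint δ α x y) (columnPoint δ α x y') ≠ 0 := by
  obtain ⟨i, a⟩ := y
  obtain ⟨i', a'⟩ := y'
  rcases eq_or_ne i i' with rfl | hi
  · refine mul_ne_zero ((h.right.two_mul i).apply_ne (1 + (a : ℕ) + (a' : ℕ))
      (by simp only [columnPoint]; push_cast; ring)) fun h0 => hy ?_
    have := h.right.step ((a : ℕ) - (a' : ℕ))
      (by rw [← h0]; simp only [columnPoint]; congr 1; push_cast; ring)
    have : a = a' := Fin.ext (by omega)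
    rw [this]
  · exact mul_ne_zero ((h.right.add i i' hi).apply_ne (1 + (a : ℕ) + (a' : ℕ))
      (by simp only [columnPoint]; push_cast; ring))
      ((h.right.sub i i' hi).apply_ne ((a : ℕ) - (a' : ℕ))
      (by simp only [columnPoint]; push_cast; ring))

/-- The denominators of the Cauchy determinant in block k, relative to the omission of index 0. -/
lemma prod_columns (h : GenericPair br δ z x) (α : Fin m → ℕ) (k : Fin L) {d : ℕ}
    (n : Fin (d + 1)) :
    ∏ i : Fin d, ∏ y, (bracketPM br (z k + (n.succAbove i : ℕ) * δ) (columnPoint δ α x y))⁻¹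
      = (∏ i : Fin d, ∏ y, (bracketPM br (z k + ((0 : Fin (d + 1)).succAbove i : ℕ) * δ)
          (columnPoint δ α x y))⁻¹)
        * ∏ i, (paramFactor br δ (z k) (δ / 2 + x i + α i * δ) n
      * (paramFactor br δ (z k) (δ / 2 - x i) n)) := by
  have n1 (n : ℕ) (y) : shiftedBracket br δ (z k + columnPoint δ α x y + δ) n ≠ 0 :=
    ((h.add k y.1).shift (1 + (y.2 : ℕ)) (by rw [columnPoint]; push_cast; ring)).shiftedBracket_ne n
  have n2 (n : ℕ) (y) : shiftedBracket br δ (z k - columnPoint δ α x y + δ) n ≠ 0 :=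
    ((h.sub k y.1).shift (-(y.2 : ℕ)) (by rw [columnPoint]; push_cast; ring)).shiftedBracket_ne n
  rw [prod_comm, prod_comm (s := (univ : Finset (Fin d))), ← prod_congr rfl fun i _ =>
    prod_columns_telescope (z k) (x i) (α i) n (h.add k i) (h.sub k i),
    ← Fintype.prod_sigma' (f := fun (i : Fin m) (a : Fin (α i)) => (paramFactor br δ (z k) (x i + δ / 2 + (a : ℕ) * δ) n
      * (paramFactor br δ (z k) (-(x i + δ / 2 + (a : ℕ) * δ)) n))⁻¹),
    ← prod_mul_distrib]
  refine prod_congr rfl fun y _ => ?_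
  rw [prod_inv_distrib, prod_inv_distrib,
    prod_succAbove_bracketPM _ _ _ (n1 _ y) (n2 _ y), prod_succAbove_bracketPM _ _ _ (n1 _ y) (n2 _ y)]
  simp [columnPoint, mul_comm]

end GenericPair

/-- Relative to its value V₀ at μ = 0, the Vandermonde product splits into blocks, which give [2z_i
+ 2μ_i δ]/[2z_i] and the diagonal cross factors, and rectangles, which give the factors for i ≠ j.
These are all the factors of `phiTerm` that do not involve w. -/
lemma GenericVars.prod_lex_pairs_eq {L : ℕ} {z : Fin L → ℂ} (hz : GenericVars br δ z)
    (hbr : IsBracket br) (γ : Fin L → ℕ) :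
    ∃ V₀ : ℂ, V₀ ≠ 0 ∧ ∀ μ : (∀ k, Fin (γ k + 1)), (-1) ^ (∑ k, (μ k : ℕ))
      * (∏ x : (Σₗ k, Fin (γ k)), ∏ y : (Σₗ k, Fin (γ k)), if x < y then
        bracketPM br (z (ofLex y).1 + ((μ (ofLex y).1).succAbove (ofLex y).2 : ℕ) * δ)
          (z (ofLex x).1 + ((μ (ofLex x).1).succAbove (ofLex x).2 : ℕ) * δ) else 1)
      = V₀ * ((∏ i, br (2 * z i + 2 * (μ i : ℕ) * δ) / br (2 * z i))
        * (∏ i, ∏ j ∈ Ioi i, bracketPM br (z i + (μ i : ℕ) * δ) (z j + (μ j : ℕ) * δ)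
            / bracketPM br (z i) (z j))
        * ∏ i, ∏ j, crossFactor br δ (z i) (z j) (γ j) (μ i)) := by
  have hne (k l : Fin L) (i j : ℕ) (h : (⟨k, i⟩ : Fin L × ℕ) ≠ ⟨l, j⟩) :
      bracketPM br (z k + i * δ) (z l + j * δ) ≠ 0 := by
    rcases eq_or_ne k l with rfl | hkl
    · refine mul_ne_zero ((hz.two_mul k).apply_ne (i + j) (by push_cast; ring)) fun h0 => h ?_
      have := hz.step (i - j) (by rw [← h0]; congr 1; push_cast; ring)
      have : i = j := by omega
      rw [this]
    · exact mul_ne_zero ((hz.add k l hkl).apply_ne (i + j) (by push_cast; ring))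
        ((hz.sub k l hkl).apply_ne (i - j) (by push_cast; ring))
  refine ⟨(∏ k, ∏ i : Fin (γ k), ∏ j : Fin (γ k), if i < j then
        bracketPM br (z k + ((0 : Fin (γ k + 1)).succAbove j : ℕ) * δ)
          (z k + ((0 : Fin (γ k + 1)).succAbove i : ℕ) * δ) else 1)
      * ∏ k, ∏ l, if k < l then ∏ i : Fin (γ k), ∏ j : Fin (γ l),
            bracketPM br (z l + ((0 : Fin (γ l + 1)).succAbove j : ℕ) * δ)
              (z k + ((0 : Fin (γ k + 1)).succAbove i : ℕ) * δ) else 1, ?_, fun μ => ?_⟩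
  · refine mul_ne_zero
      (prod_ne_zero_iff.2 fun k _ => prod_ne_zero_iff.2 fun i _ => prod_ne_zero_iff.2 fun j _ => ?_)
      (prod_ne_zero_iff.2 fun k _ => prod_ne_zero_iff.2 fun l _ => ?_)
    · split_ifs with h
      · refine hne k k _ _ fun h' => h.ne ?_
        rw [Prod.mk.injEq] at h'
        exact (Fin.succAbove_right_injective (Fin.ext h'.2)).symm
      · exact one_ne_zero
    · split_ifs with h
      · refine prod_ne_zero_iff.2 fun i _ => prod_ne_zero_iff.2 fun j _ => hne l k _ _ fun h' => ?_
        rw [Prod.mk.injEq] at h'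
        exact h.ne h'.1.symm
      · exact one_ne_zero
  · rw [prod_lex_pairs γ (fun x y => bracketPM br (z y.1 + ((μ y.1).succAbove y.2 : ℕ) * δ)
      (z x.1 + ((μ x.1).succAbove x.2 : ℕ) * δ)), ← prod_pow_eq_pow_sum, ← mul_assoc,
      ← prod_mul_distrib, prod_congr rfl fun k _ => hz.prod_pairs_block hbr k (μ k)]
    have hrect : (∏ k, ∏ l, if k < l then ∏ i : Fin (γ k), ∏ j : Fin (γ l),
        bracketPM br (z l + ((μ l).succAbove j : ℕ) * δ) (z k + ((μ k).succAbove i : ℕ) * δ) else 1)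
        = ∏ k, ∏ l, (if k < l then ∏ i : Fin (γ k), ∏ j : Fin (γ l),
            bracketPM br (z l + ((0 : Fin (γ l + 1)).succAbove j : ℕ) * δ)
              (z k + ((0 : Fin (γ k + 1)).succAbove i : ℕ) * δ) else 1)
          * ((if k < l then bracketPM br (z k + (μ k : ℕ) * δ) (z l + (μ l : ℕ) * δ)
              / bracketPM br (z k) (z l) else 1)
            * if k < l then crossFactor br δ (z k) (z l) (γ l) (μ k)
              * crossFactor br δ (z l) (z k) (γ k) (μ l) else 1) := by
      refine prod_congr rfl fun k _ => prod_congr rfl fun l _ => ?_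
      split_ifs with h
      · exact hz.prod_rectangle_block hbr h.ne (μ k) (μ l)
      · simp
    have hIoi : ∏ i, ∏ j ∈ Ioi i, bracketPM br (z i + (μ i : ℕ) * δ) (z j + (μ j : ℕ) * δ)
            / bracketPM br (z i) (z j)
        = ∏ k, ∏ l, if k < l then bracketPM br (z k + (μ k : ℕ) * δ) (z l + (μ l : ℕ) * δ)
              / bracketPM br (z k) (z l) else 1 := by
      refine prod_congr rfl fun k _ => ?_
      rw [← prod_filter]
      refine prod_congr ?_ fun _ _ => rfl
      ext; simp
    rw [hIoi, ← prod_diag_mul_prod_pairs (fun i j => crossFactor br δ (z i) (z j) (γ j) (μ i)),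
      hrect]
    simp only [prod_mul_distrib]
    ring

lemma phiTerm_eq_prod_factors {L : ℕ} {ι : Type} [Fintype ι] (γ : Fin L → ℕ) (z : Fin L → ℂ)
    (w : ι → ℂ) (μ : Fin L → ℕ) :
    phiTerm br δ γ z w μ
      = (∏ i, br (2 * z i + 2 * μ i * δ) / br (2 * z i))
        * (∏ i, ∏ j ∈ Ioi i, bracketPM br (z i + μ i * δ) (z j + μ j * δ)
            / bracketPM br (z i) (z j))
        * (∏ i, ∏ j, crossFactor br δ (z i) (z j) (γ j) (μ i))
        * ∏ i, ∏ k, paramFactor br δ (z i) (w k) (μ i) := rfl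

lemma phiTerm_sourceParams {L m : ℕ} (γ : Fin L → ℕ) (z : Fin L → ℂ) (α : Fin m → ℕ)
    (x : Fin m → ℂ) (c : ℂ) (μ : Fin L → ℕ) :
    phiTerm br δ γ z (sourceParams δ α x c) μ
      = (∏ i, br (2 * z i + 2 * μ i * δ) / br (2 * z i))
        * (∏ i, ∏ j ∈ Ioi i, bracketPM br (z i + μ i * δ) (z j + μ j * δ)
            / bracketPM br (z i) (z j))
        * (∏ i, ∏ j, crossFactor br δ (z i) (z j) (γ j) (μ i))
        * ((∏ k, paramFactor br δ (z k) c (μ k) * paramFactor br δ (z k) (-c) (μ k))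
          * ∏ k, ∏ i, paramFactor br δ (z k) (δ / 2 + x i + α i * δ) (μ k)
            * paramFactor br δ (z k) (δ / 2 - x i) (μ k)) := by
  have h : ∀ k, ∏ p, paramFactor br δ (z k) (sourceParams δ α x c p) (μ k)
      = paramFactor br δ (z k) c (μ k) * paramFactor br δ (z k) (-c) (μ k)
        * ∏ i, paramFactor br δ (z k) (δ / 2 + x i + α i * δ) (μ k)
            * paramFactor br δ (z k) (δ / 2 - x i) (μ k) := by
    intro k
    rw [Fintype.prod_sum_type, Fintype.prod_sum_type, Fin.prod_univ_two, ← prod_mul_distrib]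
    rfl
  rw [phiTerm_eq_prod_factors, prod_congr rfl fun k _ => h k, prod_mul_distrib]

lemma Phi_eq_sum_fin {L : ℕ} {ι : Type} [Fintype ι] (γ : Fin L → ℕ) (z : Fin L → ℂ) (w : ι → ℂ) :
    Phi br δ γ z w = ∑ μ : (∀ k, Fin (γ k + 1)), phiTerm br δ γ z w fun k => μ k := by
  rw [Phi]
  refine (sum_bij (fun (μ : ∀ k, Fin (γ k + 1)) _ k => (μ k : ℕ)) ?_ ?_ ?_ ?_).symm
  · exact fun μ _ => mem_Iic.2 fun k => Nat.lt_succ_iff.1 (μ k).2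
  · exact fun μ _ ν _ hμν => funext fun k => Fin.ext (congrFun hμν k)
  · exact fun ν hν => ⟨fun k => ⟨ν k, Nat.lt_succ_iff.2 (mem_Iic.1 hν k)⟩, mem_univ _, rfl⟩
  · exact fun _ _ => rfl

lemma prod_bracketPM_columnPoint (hbr : IsBracket br) {m : ℕ} (α : Fin m → ℕ) (x : Fin m → ℂ)
    (c : ℂ) : ∏ y, bracketPM br c (columnPoint δ α x y)
      = (-1) ^ (∑ i, α i) * ∏ i, shiftedBracketPM br δ (x i + δ / 2) c (α i) := by
  rw [Fintype.prod_sigma, ← prod_pow_eq_pow_sum, ← prod_mul_distrib]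
  refine prod_congr rfl fun i _ => ?_
  rw [shiftedBracketPM, ← prod_fin_eq_shiftedBracket, ← prod_fin_eq_shiftedBracket,
    ← prod_mul_distrib, ← Fin.prod_const, ← prod_mul_distrib]
  refine prod_congr rfl fun a _ => ?_
  rw [hbr.bracketPM_swap (columnPoint δ α x ⟨i, a⟩) c, neg_one_mul, bracketPM, columnPoint]
  congr 3 <;> ring

lemma shiftedBracket_ne_of_le {u : ℂ} {d n : ℕ} (hn : n ≤ d) (hu : shiftedBracket br δ u d ≠ 0) :
    shiftedBracket br δ u n ≠ 0 := by
  rw [shiftedBracket, prod_ne_zero_iff] at hu ⊢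
  exact fun j hj => hu j (mem_range.2 ((mem_range.1 hj).trans_le hn))

/-- The source identity: up to an explicit factor, `Φ` with the additional parameters `c, -c` does
not depend on `c`. -/
lemma GenericPair.exists_phi_eq {L m : ℕ} {z : Fin L → ℂ} {x : Fin m → ℂ}
    (h : GenericPair br δ z x) (hbr : IsBracket br) (γ : Fin L → ℕ) (α : Fin m → ℕ)
    (hsum : ∑ k, γ k = ∑ i, α i) :
    ∃ D₀ : ℂ, ∀ c : ℂ, (∀ k, shiftedBracket br δ (z k + c + δ) (γ k) ≠ 0) →
      (∀ k, shiftedBracket br δ (z k - c + δ) (γ k) ≠ 0) →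
      (∏ k, shiftedBracketPM br δ (z k + δ) c (γ k)) * Phi br δ γ z (sourceParams δ α x c)
        = (∏ i, shiftedBracketPM br δ (x i + δ / 2) c (α i)) * D₀ := by
  classical
  have hcard : Fintype.card (Σ k, Fin (γ k)) = Fintype.card (Σ i, Fin (α i)) := by simp [hsum]
  -- Any bijection of rows with columns will do: the order of the columns affects only the constants
  -- `κ` and `D`.
  let e := Fintype.equivOfCardEq hcard
  let X : (Σ k, Fin (γ k)) → ℂ := fun y => columnPoint δ α x (e y)
  have hX (k) (j : ℕ) (y) : bracketPM br (z k + j * δ) (X y) ≠ 0 := h.bracketPM_columnPoint_ne α k j _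
  obtain ⟨D, hD⟩ := exists_sum_det_eq hbr γ z X hX
  obtain ⟨f, g, hfg⟩ := hbr.exists_coordinates
  obtain ⟨κ, hκ, hdet⟩ := exists_det_inv_pairing f g (ι := Σₗ k, Fin (γ k)) (bracketPM br) hfg
    (fun y => X (ofLex y)) fun y y' hy => h.bracketPM_columnPoints_ne α (e.injective.ne hy)
  obtain ⟨V, hV, hVμ⟩ := h.left.prod_lex_pairs_eq hbr γ
  let W : ℂ := ∏ k, ∏ i : Fin (γ k), ∏ y,
    (bracketPM br (z k + ((0 : Fin (γ k + 1)).succAbove i : ℕ) * δ) (columnPoint δ α x y))⁻¹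
  have hW : W ≠ 0 := prod_ne_zero_iff.2 fun k _ => prod_ne_zero_iff.2 fun i _ =>
    prod_ne_zero_iff.2 fun y _ => inv_ne_zero (h.bracketPM_columnPoint_ne α k _ y)
  -- `κ * V * W` is the common factor of all terms, and the sign comes from [c ± X] = -[X ± c].
  refine ⟨(-1) ^ (∑ i, α i) * D / (κ * V * W), fun c hc1 hc2 => ?_⟩
  have hcol : ∏ y, bracketPM br c (X y)
      = (-1) ^ (∑ i, α i) * ∏ i, shiftedBracketPM br δ (x i + δ / 2) c (α i) := by
    rw [Equiv.prod_comp e (fun y => bracketPM br c (columnPoint δ α x y)), prod_bracketPM_columnPoint hbr]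
  have hterm (μ : ∀ k, Fin (γ k + 1)) : (-1 : ℂ) ^ (∑ k, (μ k : ℕ))
      * ((∏ x : (Σ k, Fin (γ k)), bracketPM br (z x.1 + ((μ x.1).succAbove x.2 : ℕ) * δ) c)
        * (Matrix.of fun x y : (Σ k, Fin (γ k)) =>
            (bracketPM br (z x.1 + ((μ x.1).succAbove x.2 : ℕ) * δ) (X y))⁻¹).det)
      = (κ * V * W) * ((∏ k, shiftedBracketPM br δ (z k + δ) c (γ k))
          * phiTerm br δ γ z (sourceParams δ α x c) fun k => μ k) := by
    have hd := hdet (fun x => z (ofLex x).1 + ((μ (ofLex x).1).succAbove (ofLex x).2 : ℕ) * δ)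
      fun x y => hX _ _ _
    have hc : ∏ x : (Σ k, Fin (γ k)), bracketPM br (z x.1 + ((μ x.1).succAbove x.2 : ℕ) * δ) c
        = (∏ k, shiftedBracketPM br δ (z k + δ) c (γ k)) * ∏ k,
          (paramFactor br δ (z k) c (μ k)
          * (paramFactor br δ (z k) (-c) (μ k))) := by
      rw [Fintype.prod_sigma, ← prod_mul_distrib]
      exact prod_congr rfl fun k _ =>
        prod_succAbove_bracketPM (z k) c (μ k)
          (shiftedBracket_ne_of_le (Nat.lt_succ_iff.1 (μ k).2) (hc1 k))
          (shiftedBracket_ne_of_le (Nat.lt_succ_iff.1 (μ k).2) (hc2 k))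
    have hw : ∏ x : (Σₗ k, Fin (γ k)), ∏ y : (Σₗ k, Fin (γ k)),
        (bracketPM br (z (ofLex x).1 + ((μ (ofLex x).1).succAbove (ofLex x).2 : ℕ) * δ)
          (X (ofLex y)))⁻¹
        = W * ∏ k, ∏ i, (paramFactor br δ (z k) (δ / 2 + x i + α i * δ) (μ k)
      * (paramFactor br δ (z k) (δ / 2 - x i) (μ k))) := by
      refine (Fintype.prod_sigma (fun x : (Σ k, Fin (γ k)) => ∏ y : (Σ k, Fin (γ k)),
        (bracketPM br (z x.1 + ((μ x.1).succAbove x.2 : ℕ) * δ) (X y))⁻¹)).trans ?_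
      rw [← prod_mul_distrib]
      refine prod_congr rfl fun k _ => ?_
      rw [← h.prod_columns α k (μ k)]
      exact prod_congr rfl fun i _ => Equiv.prod_comp e
        (fun y => (bracketPM br (z k + ((μ k).succAbove i : ℕ) * δ) (columnPoint δ α x y))⁻¹)
    rw [hw] at hd
    have hd' : (Matrix.of fun x y : (Σ k, Fin (γ k)) =>
            (bracketPM br (z x.1 + ((μ x.1).succAbove x.2 : ℕ) * δ) (X y))⁻¹).det = _ := hd
    rw [hd', hc, phiTerm_sourceParams]
    have hv := hVμ μ
    linear_combination (κ * W * (∏ k, shiftedBracketPM br δ (z k + δ) c (γ k)) * (∏ k,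
          (paramFactor br δ (z k) c (μ k)
          * (paramFactor br δ (z k) (-c) (μ k))))
          * ∏ k, ∏ i, (paramFactor br δ (z k) (δ / 2 + x i + α i * δ) (μ k)
      * (paramFactor br δ (z k) (δ / 2 - x i) (μ k)))) * hv
  have hc := hD c
  rw [sum_congr rfl fun μ _ => hterm μ, ← mul_sum, ← mul_sum, ← Phi_eq_sum_fin, hcol] at hc
  rw [mul_div_assoc', eq_div_iff (mul_ne_zero (mul_ne_zero hκ hV) hW)]
  linear_combination hc

end

/-! ### Specialization of c to one of the variables. -/

lemma prod_Ioi_succAbove {L : ℕ} (P : Fin (L + 1) → Fin (L + 1) → ℂ) (hP : ∀ i j, P i j = P j i)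
    (l : Fin (L + 1)) :
    ∏ i, ∏ j ∈ Ioi i, P i j
      = (∏ i : Fin L, P (l.succAbove i) l) * ∏ i : Fin L, ∏ j ∈ Ioi i,
          P (l.succAbove i) (l.succAbove j) := by
  have hite {d : ℕ} (Q : Fin d → Fin d → ℂ) :
      ∏ i, ∏ j ∈ Ioi i, Q i j = ∏ i, ∏ j, if i < j then Q i j else 1 := by
    refine prod_congr rfl fun i _ => ?_
    rw [← prod_filter]
    exact prod_congr (by ext; simp) fun _ _ => rfl
  rw [hite, hite (fun i j => P (l.succAbove i) (l.succAbove j)), Fin.prod_univ_succAbove _ l,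
    Fin.prod_univ_succAbove _ l, if_neg (lt_irrefl l), one_mul, ← prod_mul_distrib,
    ← prod_mul_distrib]
  refine prod_congr rfl fun i _ => ?_
  rw [Fin.prod_univ_succAbove _ l, ← mul_assoc]
  simp only [Fin.succAbove_lt_succAbove_iff]
  congr 1
  rcases lt_or_gt_of_ne (Fin.succAbove_ne l i) with h | h
  · rw [if_pos h, if_neg h.not_gt, one_mul]
  · rw [if_pos h, if_neg h.not_gt, mul_one, hP]

section
variable {br : ℂ → ℂ} {δ : ℂ}

@[simp] lemma crossFactor_zero (z w : ℂ) (d : ℕ) : crossFactor br δ z w d 0 = 1 := by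
  simp [crossFactor]

/-- A variable w with bound d whose own index stays 0 acts on the other variables like the
parameters w, -w - dδ; this is the origin of v, -v - sδ in the theorem. -/
lemma crossFactor_eq_paramFactor_mul (z w : ℂ) (d m : ℕ) :
    crossFactor br δ z w d m = paramFactor br δ z w m * paramFactor br δ z (-w - d * δ) m := by
  rw [crossFactor, paramFactor, paramFactor, div_mul_div_comm, mul_comm (shiftedBracket br δ
    (z + w + (d + 1) * δ) m), show z + (-w - d * δ) = z - w - d * δ by ring,
    show z - (-w - d * δ) + δ = z + w + (d + 1) * δ by ring]

/-- From [a][a+δ]_m = [a]_m [a+mδ] at a = z ± c: the parameters c, -c cancel the pair factor with a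
variable that equals c and does not move. -/
lemma bracketPM_div_mul_paramFactor {z c : ℂ} (hadd : ShiftNonvanishing br δ (z + c))
    (hsub : ShiftNonvanishing br δ (z - c)) (m : ℕ) :
    bracketPM br (z + m * δ) c / bracketPM br z c
      * (paramFactor br δ z c m * paramFactor br δ z (-c) m) = 1 := by
  have e1 := mul_shiftedBracket_add_step br δ m (z + c)
  have e2 := mul_shiftedBracket_add_step br δ m (z - c)
  have n1 := (hadd.shift 1 (b := z + c + δ) (by push_cast; ring)).shiftedBracket_ne m
  have n2 := (hsub.shift 1 (b := z - c + δ) (by push_cast; ring)).shiftedBracket_ne m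
  have n3 : br (z + c) ≠ 0 := hadd.apply_ne 0 (by simp)
  have n4 : br (z - c) ≠ 0 := hsub.apply_ne 0 (by simp)
  rw [bracketPM, bracketPM, paramFactor, paramFactor, sub_neg_eq_add, ← sub_eq_add_neg,
    div_mul_div_comm, div_mul_div_comm, div_eq_one_iff_eq (mul_ne_zero (mul_ne_zero n3 n4)
    (mul_ne_zero n2 n1)), show z + m * δ + c = z + c + m * δ by ring,
    show z + m * δ - c = z - c + m * δ by ring]
  linear_combination (-shiftedBracket br δ (z - c) m * br (z - c + m * δ)) * e1
    - br (z + c) * shiftedBracket br δ (z + c + δ) m * e2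

lemma phiTerm_sourceParams_self {L m : ℕ} {z : Fin (L + 1) → ℂ} (hz : GenericVars br δ z)
    (hbr : IsBracket br) (γ : Fin (L + 1) → ℕ) (α : Fin m → ℕ) (x : Fin m → ℂ) (l : Fin (L + 1))
    (μ : Fin (L + 1) → ℕ) (hμ : μ l = 0) :
    phiTerm br δ γ z (sourceParams δ α x (z l)) μ
      = phiTerm br δ (γ ∘ l.succAbove) (z ∘ l.succAbove) (kmParams δ α x (z l) (γ l))
          (μ ∘ l.succAbove) := by
  have h2 : br (2 * z l) ≠ 0 := (hz.two_mul l).apply_ne 0 (by simp)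
  have hparam (i : Fin L) : ∏ k, paramFactor br δ (z (l.succAbove i))
      (kmParams δ α x (z l) (γ l) k) (μ (l.succAbove i))
      = bracketPM br (z (l.succAbove i) + μ (l.succAbove i) * δ) (z l + μ l * δ)
          / bracketPM br (z (l.succAbove i)) (z l)
        * crossFactor br δ (z (l.succAbove i)) (z l) (γ l) (μ (l.succAbove i))
        * ∏ k, paramFactor br δ (z (l.succAbove i)) (sourceParams δ α x (z l) k)
            (μ (l.succAbove i)) := by
    have hone := bracketPM_div_mul_paramFactor (hz.add _ _ (Fin.succAbove_ne l i))
      (hz.sub _ _ (Fin.succAbove_ne l i)) (μ (l.succAbove i))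
    rw [hμ, Nat.cast_zero, zero_mul, add_zero, crossFactor_eq_paramFactor_mul]
    simp only [Fintype.prod_sum_type, Fin.prod_univ_two, kmParams, sourceParams, Sum.elim_inl, Sum.elim_inr, Matrix.cons_val_zero,
      Matrix.cons_val_one]
    linear_combination (-paramFactor br δ (z (l.succAbove i)) (z l) (μ (l.succAbove i))
      * paramFactor br δ (z (l.succAbove i)) (-z l - γ l * δ) (μ (l.succAbove i))
      * ((∏ k, paramFactor br δ (z (l.succAbove i)) (δ / 2 + x k + α k * δ) (μ (l.succAbove i)))
        * ∏ k, paramFactor br δ (z (l.succAbove i)) (δ / 2 - x k) (μ (l.succAbove i)))) * hone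
  have hcross (i : Fin L) : ∏ j, crossFactor br δ (z (l.succAbove i)) (z j) (γ j) (μ (l.succAbove i))
      = crossFactor br δ (z (l.succAbove i)) (z l) (γ l) (μ (l.succAbove i))
        * ∏ j, crossFactor br δ (z (l.succAbove i)) (z (l.succAbove j)) (γ (l.succAbove j))
          (μ (l.succAbove i)) := Fin.prod_univ_succAbove _ l
  rw [phiTerm_eq_prod_factors, phiTerm_eq_prod_factors, prod_Ioi_succAbove _ (fun i j => ?_) l,
    Fin.prod_univ_succAbove (fun i => br (2 * z i + 2 * μ i * δ) / br (2 * z i)) l,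
    Fin.prod_univ_succAbove (fun i => ∏ j, crossFactor br δ (z i) (z j) (γ j) (μ i)) l,
    Fin.prod_univ_succAbove (fun i => ∏ k, paramFactor br δ (z i) _ (μ i)) l,
    prod_congr rfl fun i _ => hcross i]
  · simp only [Function.comp_apply, hparam, prod_mul_distrib]
    rw [hμ]
    simp only [crossFactor_zero, paramFactor_zero, prod_const_one, Nat.cast_zero, mul_zero,
      zero_mul, add_zero, div_self h2]
    ring
  · rw [hbr.bracketPM_swap (z i), hbr.bracketPM_swap (z i + _), neg_div_neg_eq]

/-- When `c` is one of the variables, the sum with the parameters `c, -c` reduces to a sum with one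
variable less. -/
lemma Phi_sourceParams_self {L m : ℕ} {z : Fin (L + 1) → ℂ} (hz : GenericVars br δ z)
    (hbr : IsBracket br) (γ : Fin (L + 1) → ℕ) (α : Fin m → ℕ) (x : Fin m → ℂ) (l : Fin (L + 1)) :
    Phi br δ γ z (sourceParams δ α x (z l))
      = Phi br δ (γ ∘ l.succAbove) (z ∘ l.succAbove) (kmParams δ α x (z l) (γ l)) := by
  rw [Phi, Phi]
  symm
  refine sum_of_injOn (fun ν => l.insertNth (α := fun _ => ℕ) 0 ν) ?_ ?_ ?_ ?_
  · intro ν _ ν' _ h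
    exact (Fin.insertNth_injective2 h).2
  · intro ν hν
    rw [mem_coe, mem_Iic] at hν ⊢
    intro i
    refine Fin.succAboveCases l ?_ (fun j => ?_) i
    · simp
    · simpa using hν j
  · intro μ hμ hne
    have hl : μ l ≠ 0 := by
      intro h0
      refine hne ⟨μ ∘ l.succAbove, ?_, ?_⟩
      · rw [mem_coe, mem_Iic]
        exact fun i => mem_Iic.1 hμ _
      · funext i
        refine Fin.succAboveCases l ?_ (fun j => ?_) i
        · simp [h0]
        · simp
    -- For μ_l ≠ 0 the parameter -z_l contributes a numerator [z_l - z_l]_{μ_l}, whose first factor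
    -- is [0] = 0.
    rw [phiTerm_eq_prod_factors]
    refine mul_eq_zero_of_right _ (prod_eq_zero (mem_univ l)
      (prod_eq_zero (mem_univ (Sum.inl 1)) ?_))
    rw [paramFactor, shiftedBracket, prod_eq_zero (mem_range.2 (Nat.pos_of_ne_zero hl)), zero_div]
    simp [sourceParams, hbr.zero]
  · intro ν _
    rw [phiTerm_sourceParams_self hz hbr γ α x l _ (by simp)]
    congr 1
    funext i
    simp

end

/-! ### The transformation for generic variables. -/

section
variable {br : ℂ → ℂ} {δ : ℂ}

/-- The transformation formula for generic variables. -/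
lemma karlssonMinton_of_generic (hbr : IsBracket br) {N r s m n : ℕ} (α : Fin m → ℕ)
    (β : Fin n → ℕ) (hα : ∑ i, α i = N + r + s) (hβ : ∑ k, β k = N) (x : Fin m → ℂ)
    (y : Fin n → ℂ) (u v : ℂ) (h : GenericPair br δ (appendVar (appendVar y u) v) x) :
    (shiftedBracketPM br δ (v + δ) v s * shiftedBracketPM br δ (u + δ) v r
        * ∏ k, shiftedBracketPM br δ (y k + δ) v (β k))
      / (∏ i, shiftedBracketPM br δ (x i + δ / 2) v (α i))
      * Phi br δ (appendIndex β r) (appendVar y u) (kmParams δ α x v s)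
    = (shiftedBracketPM br δ (u + δ) u r * shiftedBracketPM br δ (v + δ) u s
        * ∏ k, shiftedBracketPM br δ (y k + δ) u (β k))
      / (∏ i, shiftedBracketPM br δ (x i + δ / 2) u (α i))
      * Phi br δ (appendIndex β s) (appendVar y v) (kmParams δ α x u r) := by
  set z := appendVar (appendVar y u) v with hz
  set γ := appendIndex (appendIndex β r) s with hγ
  have hsum : ∑ k, γ k = ∑ i, α i := by
    simp [hγ, appendIndex, Fin.sum_univ_castSucc, hα, hβ]
  obtain ⟨D, hD⟩ := h.exists_phi_eq hbr γ α hsum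
  have hδ (d : ℕ) : shiftedBracket br δ δ d ≠ 0 := by
    refine prod_ne_zero_iff.2 fun j _ h0 => ?_
    have := h.left.step (j + 1) (by rw [← h0]; congr 1; push_cast; ring)
    omega
  have hc1 (l k) : shiftedBracket br δ (z k + z l + δ) (γ k) ≠ 0 := by
    rcases eq_or_ne k l with rfl | hkl
    · exact ((h.left.two_mul k).shift 1 (by push_cast; ring)).shiftedBracket_ne _
    · exact ((h.left.add k l hkl).shift 1 (by push_cast; ring)).shiftedBracket_ne _
  have hc2 (l k) : shiftedBracket br δ (z k - z l + δ) (γ k) ≠ 0 := by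
    rcases eq_or_ne k l with rfl | hkl
    · rw [sub_self, zero_add]; exact hδ _
    · exact ((h.left.sub k l hkl).shift 1 (by push_cast; ring)).shiftedBracket_ne _
  have hx (l) : ∏ i, shiftedBracketPM br δ (x i + δ / 2) (z l) (α i) ≠ 0 := by
    refine prod_ne_zero_iff.2 fun i _ => mul_ne_zero ?_ ?_
    · exact ((h.add l i).shift 0 (by push_cast; ring)).shiftedBracket_ne _
    · exact (((h.sub l i).neg hbr).shift 1 (by push_cast; ring)).shiftedBracket_ne _
  -- The constant `D` is the same for every l; c = v and c = u are the last two positions of z, and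
  -- both sides turn out to equal `D`.
  have hmain (l) := hD (z l) (hc1 l) (hc2 l)
  simp only [Phi_sourceParams_self h.left hbr] at hmain
  have hlast := hmain (Fin.last _)
  have hprev := hmain (Fin.last _).castSucc
  have zl : z (Fin.last _) = v := by simp [hz, appendVar]
  have zp : z (Fin.last _).castSucc = u := by simp [hz, appendVar]
  have γl : γ (Fin.last _) = s := by simp [hγ, appendIndex]
  have γp : γ (Fin.last _).castSucc = r := by simp [hγ, appendIndex]
  have zl' : z ∘ (Fin.last _).succAbove = appendVar y u := by
    funext k; simp [hz, appendVar]
  have γl' : γ ∘ (Fin.last _).succAbove = appendIndex β r := by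
    funext k; simp [hγ, appendIndex]
  have hsa : ((Fin.last n).castSucc.succAbove (Fin.last n)) = Fin.last (n + 1) := by
    simp [Fin.succAbove]
  have hsc (k : Fin n) : ((Fin.last n).castSucc.succAbove k.castSucc) = k.castSucc.castSucc := by
    rw [Fin.succAbove_of_castSucc_lt _ _ (by simp [Fin.lt_def])]
  have zp' : z ∘ (Fin.last _).castSucc.succAbove = appendVar y v := by
    funext k
    induction k using Fin.lastCases with
    | last => simp [hz, appendVar, hsa]
    | cast k => simp [hz, appendVar, hsc]
  have γp' : γ ∘ (Fin.last _).castSucc.succAbove = appendIndex β s := by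
    funext k
    induction k using Fin.lastCases with
    | last => simp [hγ, appendIndex, hsa]
    | cast k => simp [hγ, appendIndex, hsc]
  have hprod (c : ℂ) : ∏ k, shiftedBracketPM br δ (z k + δ) c (γ k)
      = (∏ k, shiftedBracketPM br δ (y k + δ) c (β k)) * shiftedBracketPM br δ (u + δ) c r
        * shiftedBracketPM br δ (v + δ) c s := by
    simp [hz, hγ, appendVar, appendIndex, Fin.prod_univ_castSucc]
  have hxl := hx (Fin.last _)
  have hxp := hx (Fin.last _).castSucc
  rw [zl] at hxl
  rw [zp] at hxp
  rw [hprod, zl, zl', γl, γl'] at hlast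
  rw [hprod, zp, zp', γp, γp'] at hprev
  trans D
  · rw [div_mul_eq_mul_div, div_eq_iff hxl]
    linear_combination hlast
  · rw [div_mul_eq_mul_div, eq_div_iff hxp]
    linear_combination -hprev

/-! ### Removal of genericity by Baire category and continuity. -/

open Filter Topology

/-- By the identity theorem the nonvanishing set is dense, and it is open. Residual sets are used
because genericity consists of countably many such conditions, one for each shift in ℤδ. -/
lemma IsBracket.eventually_residual_ne (hbr : IsBracket br) (a : ℂ) {b : ℂ} (hb : b ≠ 0) :
    ∀ᶠ t in residual ℂ, br (a + t * b) ≠ 0 := by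
  have hd : Differentiable ℂ fun t => br (a + t * b) :=
    hbr.entire.comp (by fun_prop)
  refine residual_of_dense_open (hd.continuous.isOpen_preimage _ isOpen_ne) fun t₀ => ?_
  rw [mem_closure_iff_frequently]
  intro hev
  obtain ⟨w, hw⟩ := hbr.ne_zero
  refine hw ?_
  have han : AnalyticOnNhd ℂ (fun t => br (a + t * b)) Set.univ :=
    hd.differentiableOn.analyticOnNhd isOpen_univ
  have h0 := han.eqOn_zero_of_preconnected_of_eventuallyEq_zero isPreconnected_univ
    (Set.mem_univ t₀) (hev.mono fun t ht => not_not.1 ht) (Set.mem_univ ((w - a) / b))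
  simpa [div_mul_cancel₀ _ hb] using h0

lemma IsBracket.eventually_residual_shift (hbr : IsBracket br) {f : ℂ → ℂ} (a : ℂ) {b : ℂ}
    (hb : b ≠ 0) (hf : ∀ t, f t = a + t * b) :
    ∀ᶠ t in residual ℂ, ShiftNonvanishing br δ (f t) := by
  refine eventually_countable_forall.2 fun j => ?_
  filter_upwards [hbr.eventually_residual_ne (a + j * δ) hb] with t ht
  rw [hf]
  convert ht using 2
  ring

lemma IsBracket.eventually_residual_genericVars (hbr : IsBracket br)
    (hδ : ∀ k : ℤ, br (k * δ) = 0 → k = 0) {L : ℕ} (z b : Fin L → ℂ)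
    (hb : ∀ k l, b k + b l ≠ 0) (hb' : Function.Injective b) :
    ∀ᶠ t in residual ℂ, GenericVars br δ fun k => z k + t * b k := by
  have h1 : ∀ᶠ t in residual ℂ, ∀ k, ShiftNonvanishing br δ (2 * (z k + t * b k)) :=
    eventually_countable_forall.2 fun k =>
      hbr.eventually_residual_shift (2 * z k) (hb k k) fun t => by ring
  have h2 : ∀ᶠ t in residual ℂ, ∀ k l,
      ShiftNonvanishing br δ ((z k + t * b k) + (z l + t * b l)) :=
    eventually_countable_forall.2 fun k => eventually_countable_forall.2 fun l =>
      hbr.eventually_residual_shift (z k + z l) (hb k l) fun t => by ring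
  have h3 : ∀ᶠ t in residual ℂ, ∀ k l, k ≠ l →
      ShiftNonvanishing br δ ((z k + t * b k) - (z l + t * b l)) :=
    eventually_countable_forall.2 fun k => eventually_countable_forall.2 fun l =>
      eventually_countable_forall.2 fun hkl =>
        hbr.eventually_residual_shift (z k - z l) (sub_ne_zero.2 (hb'.ne hkl)) fun t => by ring
  filter_upwards [h1, h2, h3] with t h1 h2 h3
  exact ⟨hδ, h1, fun k l _ => h2 k l, h3⟩

/-- The slopes 1, …, L for z and L + 1, …, L + m for x are positive and distinct, so every sum or
difference that must avoid zeros is nonconstant in t. -/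
lemma IsBracket.eventually_residual_genericPair (hbr : IsBracket br)
    (hδ : ∀ k : ℤ, br (k * δ) = 0 → k = 0) {L m : ℕ} (z : Fin L → ℂ) (x : Fin m → ℂ) :
    ∀ᶠ t in residual ℂ, GenericPair br δ (fun k => z k + t * ((k : ℕ) + 1 : ℕ))
      (fun i => x i + t * (L + i + 1 : ℕ)) := by
  have h1 := hbr.eventually_residual_genericVars hδ z (fun k => (((k : ℕ) + 1 : ℕ) : ℂ))
    (fun k l => by norm_cast) (fun k l h => Fin.ext (by simpa using h))
  have h2 := hbr.eventually_residual_genericVars hδ x (fun i => ((L + i + 1 : ℕ) : ℂ))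
    (fun k l => by norm_cast) (fun k l h => Fin.ext (by simpa using h))
  have h3 : ∀ᶠ t in residual ℂ, ∀ (k : Fin L) (i : Fin m), ShiftNonvanishing br δ
      ((z k + t * ((k : ℕ) + 1 : ℕ)) + (x i + t * (L + i + 1 : ℕ)) + δ / 2) :=
    eventually_countable_forall.2 fun k => eventually_countable_forall.2 fun i =>
      hbr.eventually_residual_shift (z k + x i + δ / 2)
        (b := (((k : ℕ) + 1 + (L + i + 1) : ℕ) : ℂ)) (by norm_cast) fun t => by push_cast; ring
  have h4 : ∀ᶠ t in residual ℂ, ∀ (k : Fin L) (i : Fin m), ShiftNonvanishing br δ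
      ((z k + t * ((k : ℕ) + 1 : ℕ)) - (x i + t * (L + i + 1 : ℕ)) + δ / 2) :=
    eventually_countable_forall.2 fun k => eventually_countable_forall.2 fun i =>
      hbr.eventually_residual_shift (z k - x i + δ / 2)
        (b := (((k : ℕ) + 1 : ℕ) : ℂ) - ((L + i + 1 : ℕ) : ℂ))
        (sub_ne_zero.2 fun h => by
          have h' : (k : ℕ) + 1 = L + i + 1 := by exact_mod_cast h
          omega) fun t => by ring
  filter_upwards [h1, h2, h3, h4] with t h1 h2 h3 h4
  exact ⟨h1, h2, h3, h4⟩

lemma IsBracket.continuous_shiftedBracket (hbr : IsBracket br) (k : ℕ) :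
    Continuous fun u => shiftedBracket br δ u k := by
  have := hbr.entire.continuous
  unfold shiftedBracket
  fun_prop

lemma IsBracket.continuous_shiftedBracketPM (hbr : IsBracket br) (k : ℕ) {f g : ℂ → ℂ}
    (hf : Continuous f) (hg : Continuous g) :
    Continuous fun t => shiftedBracketPM br δ (f t) (g t) k :=
  ((hbr.continuous_shiftedBracket k).comp (hf.add hg)).mul
    ((hbr.continuous_shiftedBracket k).comp (hf.sub hg))

lemma IsBracket.continuousAt_Phi (hbr : IsBracket br) {L : ℕ} {ι : Type} [Fintype ι]
    (γ : Fin L → ℕ) {z : ℂ → Fin L → ℂ} {w : ℂ → ι → ℂ} (hz : ∀ i, Continuous fun t => z t i)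
    (hw : ∀ k, Continuous fun t => w t k) {t₀ : ℂ} (h : PhiDefined br δ γ (z t₀) (w t₀)) :
    ContinuousAt (fun t => Phi br δ γ (z t) (w t)) t₀ := by
  have hb := hbr.entire.continuous
  have hs (k : ℕ) := hbr.continuous_shiftedBracket (δ := δ) k
  unfold Phi phiTerm
  refine tendsto_finsetSum _ fun μ hμ => ?_
  have hμ' := mem_Iic.1 hμ
  refine ContinuousAt.mul (ContinuousAt.mul (ContinuousAt.mul ?_ ?_) ?_) ?_
  · refine tendsto_finsetProd _ fun i _ => ContinuousAt.div ?_ ?_ (h.two_mul i)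
    · exact (hb.comp (((hz i).const_mul 2).add continuous_const)).continuousAt
    · exact (hb.comp ((hz i).const_mul 2)).continuousAt
  · refine tendsto_finsetProd _ fun i _ => tendsto_finsetProd _ fun j hj =>
      ContinuousAt.div ?_ ?_ ?_
    · have h1 := hz i
      have h2 := hz j
      exact Continuous.continuousAt (by fun_prop)
    · have h1 := hz i
      have h2 := hz j
      exact Continuous.continuousAt (by fun_prop)
    · have := h.add_sub i j (mem_Ioi.1 hj)
      exact mul_ne_zero this.1 this.2
  · refine tendsto_finsetProd _ fun i _ => tendsto_finsetProd _ fun j _ =>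
      ContinuousAt.div ?_ ?_ ?_
    · have h1 := hz i
      have h2 := hz j
      exact (((hs _).comp (h1.add h2)).mul
        ((hs _).comp ((h1.sub h2).sub continuous_const))).continuousAt
    · have h1 := hz i
      have h2 := hz j
      exact (((hs _).comp ((h1.add h2).add continuous_const)).mul
        ((hs _).comp ((h1.sub h2).add continuous_const))).continuousAt
    · exact mul_ne_zero (shiftedBracket_ne_of_le (hμ' i) (h.shift_add i j))
        (shiftedBracket_ne_of_le (hμ' i) (h.shift_sub i j))
  · refine tendsto_finsetProd _ fun i _ => tendsto_finsetProd _ fun k _ =>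
      ContinuousAt.div ?_ ?_ (shiftedBracket_ne_of_le (hμ' i) (h.param i k))
    · exact ((hs _).comp ((hz i).add (hw k))).continuousAt
    · exact ((hs _).comp (((hz i).sub (hw k)).add continuous_const)).continuousAt

lemma continuous_appendVar {n : ℕ} {y : ℂ → Fin n → ℂ} {u : ℂ → ℂ}
    (hy : ∀ k, Continuous fun t => y t k) (hu : Continuous u) (k : Fin (n + 1)) :
    Continuous fun t => appendVar (y t) (u t) k := by
  induction k using Fin.lastCases with
  | last => simpa [appendVar] using hu
  | cast k => simpa [appendVar] using hy k

lemma continuous_kmParams {m : ℕ} (α : Fin m → ℕ) {x : ℂ → Fin m → ℂ} {v : ℂ → ℂ} (s : ℕ)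
    (hx : ∀ i, Continuous fun t => x t i) (hv : Continuous v) (k : Fin 2 ⊕ (Fin m ⊕ Fin m)) :
    Continuous fun t => kmParams δ α (x t) (v t) s k := by
  rcases k with k | k | k
  · fin_cases k
    · simpa [kmParams] using hv
    · exact hv.neg.sub continuous_const
  · have := hx k
    simp only [kmParams, Sum.elim_inl, Sum.elim_inr]
    fun_prop
  · have := hx k
    simp only [kmParams, Sum.elim_inr]
    fun_prop

/-- One statement serves both sides of the theorem, which are exchanged by (u, r) ↔ (v, s). -/
lemma IsBracket.continuousAt_karlssonMinton_side (hbr : IsBracket br) {r s m n : ℕ}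
    (α : Fin m → ℕ) (β : Fin n → ℕ) {x : ℂ → Fin m → ℂ} {y : ℂ → Fin n → ℂ} {u v : ℂ → ℂ}
    (hx : ∀ i, Continuous fun t => x t i) (hy : ∀ k, Continuous fun t => y t k)
    (hu : Continuous u) (hv : Continuous v) {t₀ : ℂ}
    (hxv : ∀ i, shiftedBracketPM br δ (x t₀ i + δ / 2) (v t₀) (α i) ≠ 0)
    (h : PhiDefined br δ (appendIndex β r) (appendVar (y t₀) (u t₀))
      (kmParams δ α (x t₀) (v t₀) s)) :
    ContinuousAt (fun t => (shiftedBracketPM br δ (v t + δ) (v t) s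
        * shiftedBracketPM br δ (u t + δ) (v t) r
        * ∏ k, shiftedBracketPM br δ (y t k + δ) (v t) (β k))
      / (∏ i, shiftedBracketPM br δ (x t i + δ / 2) (v t) (α i))
      * Phi br δ (appendIndex β r) (appendVar (y t) (u t)) (kmParams δ α (x t) (v t) s)) t₀ := by
  refine ContinuousAt.mul (ContinuousAt.div ?_ ?_ (prod_ne_zero_iff.2 fun i _ => hxv i))
    (hbr.continuousAt_Phi _ (continuous_appendVar hy hu) (continuous_kmParams α s hx hv) h)
  · refine Continuous.continuousAt (Continuous.mul (Continuous.mul ?_ ?_)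
      (continuous_finsetProd _ fun k _ => ?_))
    · exact hbr.continuous_shiftedBracketPM s (hv.add continuous_const) hv
    · exact hbr.continuous_shiftedBracketPM r (hu.add continuous_const) hv
    · exact hbr.continuous_shiftedBracketPM _ ((hy k).add continuous_const) hv
  · exact Continuous.continuousAt (continuous_finsetProd _ fun i _ =>
      hbr.continuous_shiftedBracketPM _ ((hx i).add continuous_const) hv)

end

theorem mainTheorem7 (br : ℂ → ℂ) (hbr : IsBracket br)
    (δ : ℂ) (hδ : δ ≠ 0) (hδΩ : ∀ k : ℤ, br (k * δ) = 0 → k = 0)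
    (N r s m n : ℕ) (α : Fin m → ℕ) (β : Fin n → ℕ)
    (hα : ∑ i, α i = N + r + s) (hβ : ∑ k, β k = N)
    (x : Fin m → ℂ) (y : Fin n → ℂ) (u v : ℂ)
    (hxv : ∀ i, shiftedBracketPM br δ (x i + δ / 2) v (α i) ≠ 0)
    (hxu : ∀ i, shiftedBracketPM br δ (x i + δ / 2) u (α i) ≠ 0)
    (hleft : PhiDefined br δ (appendIndex β r) (appendVar y u) (kmParams δ α x v s))
    (hright : PhiDefined br δ (appendIndex β s) (appendVar y v) (kmParams δ α x u r)) :
    (shiftedBracketPM br δ (v + δ) v s * shiftedBracketPM br δ (u + δ) v r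
        * ∏ k, shiftedBracketPM br δ (y k + δ) v (β k))
      / (∏ i, shiftedBracketPM br δ (x i + δ / 2) v (α i))
      * Phi br δ (appendIndex β r) (appendVar y u) (kmParams δ α x v s)
    = (shiftedBracketPM br δ (u + δ) u r * shiftedBracketPM br δ (v + δ) u s
        * ∏ k, shiftedBracketPM br δ (y k + δ) u (β k))
      / (∏ i, shiftedBracketPM br δ (x i + δ / 2) u (α i))
      * Phi br δ (appendIndex β s) (appendVar y v) (kmParams δ α x u r) := by

  -- The slopes of `IsBracket.eventually_residual_genericPair` for (y, u, v), of length n + 2: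
  -- position plus one there, and n + 2 + i + 1 for x_i.
  let xt : ℂ → Fin m → ℂ := fun t i => x i + t * (n + 1 + 1 + i + 1 : ℕ)
  let yt : ℂ → Fin n → ℂ := fun t k => y k + t * ((k : ℕ) + 1 : ℕ)
  let ut : ℂ → ℂ := fun t => u + t * (n + 1 : ℕ)
  let vt : ℂ → ℂ := fun t => v + t * (n + 1 + 1 : ℕ)
  have hxt (i) : Continuous fun t => xt t i := by simp only [xt]; fun_prop
  have hyt (k) : Continuous fun t => yt t k := by simp only [yt]; fun_prop
  have hut : Continuous ut := by simp only [ut]; fun_prop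
  have hvt : Continuous vt := by simp only [vt]; fun_prop
  have x0 : xt 0 = x := by funext i; simp [xt]
  have y0 : yt 0 = y := by funext i; simp [yt]
  have u0 : ut 0 = u := by simp [ut]
  have v0 : vt 0 = v := by simp [vt]
  have hL := hbr.continuousAt_karlssonMinton_side (δ := δ) (r := r) (s := s) α β hxt hyt hut hvt
    (t₀ := 0) (by rwa [x0, v0]) (by rwa [x0, y0, u0, v0])
  have hR := hbr.continuousAt_karlssonMinton_side (δ := δ) (r := s) (s := r) α β hxt hyt hvt hut
    (t₀ := 0) (by rwa [x0, u0]) (by rwa [x0, y0, u0, v0])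
  -- Residual sets are dense, so generic t occur arbitrarily close to 0; both sides agree there and
  -- are continuous at t = 0, hence agree at t = 0.
  have hgen := dense_of_mem_residual
    (hbr.eventually_residual_genericPair hδΩ (appendVar (appendVar y u) v) x) 0
  rw [mem_closure_iff_frequently] at hgen
  have key := tendsto_nhds_unique_of_frequently_eq hL.tendsto hR.tendsto (hgen.mono fun t ht => by
    refine karlssonMinton_of_generic hbr α β hα hβ (xt t) (yt t) (ut t) (vt t) ?_
    have hzt : appendVar (appendVar (yt t) (ut t)) (vt t)
        = fun k => appendVar (appendVar y u) v k + t * ((k : ℕ) + 1 : ℕ) := ?_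
    · rw [hzt]
      exact ht
    funext k
    induction k using Fin.lastCases with
    | last => simp [appendVar, vt]
    | cast k =>
      induction k using Fin.lastCases with
      | last => simp [appendVar, ut]
      | cast k => simp [appendVar, yt])
  simpa only [x0, y0, u0, v0] using key
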